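/- For a commutative $\mathbb{C}$-algebra $R$ and $X=\operatorname{Spec} R$, the arc space $X_\infty$ is the affine scheme over $\mathbb{C}$ with $X_\infty(A)=\operatorname{Hom}_{\mathbb{C}\text{-alg}}(R,A[[t]])$ for every commutative $\mathbb{C}$-algebra $A$. For $r\in R$ and $k\ge 0$ let $r_k\in\mathcal{O}(X_\infty)$ be the function whose value at an arc $\gamma\colon R\to A[[t]]$ is the coefficient of $t^k$ in $\gamma(r)$; the $r_k$ generate $\mathcal{O}(X_\infty)$. There is a unique $\mathbb{C}$-linear derivation $D$ of $\mathcal{O}(X_\infty)$ with $D(r_k)=(k+1)r_{k+1}$ for all $r,k$, and $R$ maps to $\mathcal{O}(X_\infty)$ by $r\mapsto r_0$. A morphism $p\colon X\to Y$ of affine schemes induces $p_\infty\colon X_\infty\to Y_\infty$ and $p_\infty^*\colon\mathcal{O}(Y_\infty)\to\mathcal{O}(X_\infty)$. Let $n,\ell\ge 0$ be integers, let $G=\operatorname{SL}_n$ over $\mathbb{C}$ act on $V=\ell\,\mathbb{C}^n$, the direct sum of $\ell$ copies of the standard representation, let $Z=\operatorname{Spec}(\mathcal{O}(V)^G)$,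 and let $p\colon V\to Z$ be the categorical quotient, dual to the inclusion $\mathcal{O}(V)^G\subseteq\mathcal{O}(V)$. The arc group $G_\infty$, with $G_\infty(A)=\operatorname{SL}_n(A[[t]])$, acts on $V_\infty$, whose $A$-points are the $n\times\ell$ matrices over $A[[t]]$, by left multiplication; $\mathcal{O}(V_\infty)^{G_\infty}$ is the ring of functions $f$ on $V_\infty$ with $f(gv)=f(v)$ for all $A$, all $g\in G_\infty(A)$ and all $v\in V_\infty(A)$. Theorem. (1) The image of $p_\infty^*\colon\mathcal{O}(Z_\infty)\to\mathcal{O}(V_\infty)$ is exactly $\mathcal{O}(V_\infty)^{G_\infty}$: $$p_\infty^*\mathcal{O}(Z_\infty)=\mathcal{O}(V_\infty)^{G_\infty}.$$ (2) Consequently $\mathcal{O}(V_\infty)^{G_\infty}$ is generated as a differential algebra by the determinants: it is the smallest $D$-stable $\mathbb{C}$-subalgebra of $\mathcal{O}(V_\infty)$ that contains, for all $1\le j_1<\dots<j_n\le\ell$, (the image under $r\mapsto r_0$ of) the determinant $[x^{(j_1)},\dots,x^{(j_n)}]=\det\bigl(x_i^{(j_k)}\bigr)_{1\le i,k\le n}$,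 where $x_1^{(j)},\dots,x_n^{(j)}$ are the coordinates on the $j$-th copy of $\mathbb{C}^n$. -/

import Mathlib

open scoped PowerSeries

noncomputable section

/-! ### Arc spaces of affine schemes over `ℂ`

For a commutative `ℂ`-algebra `R`, the arc space `(Spec R)_∞` is the affine scheme representing the
functor `A ↦ Hom_ℂ-alg(R, A⟦t⟧)`.  Its coordinate ring is generated by symbols `r_k`
(`r ∈ R`, `k ∈ ℕ`) subject to the relations which say that `r ↦ ∑ r_k t^k` is a homomorphism of
`ℂ`-algebras. -/

namespace Arc

variable (R : Type*) [CommRing R] [Algebra ℂ R]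

/-- The relations saying that `r ↦ ∑ r_k t^k` is a homomorphism of `ℂ`-algebras. -/
inductive Rel : MvPolynomial (R × ℕ) ℂ → Prop
  | add (r s : R) (k : ℕ) :
      Rel (MvPolynomial.X (r + s, k) - (MvPolynomial.X (r, k) + MvPolynomial.X (s, k)))
  | mul (r s : R) (k : ℕ) :
      Rel (MvPolynomial.X (r * s, k) -
        ∑ p ∈ Finset.HasAntidiagonal.antidiagonal k, MvPolynomial.X (r, p.1) * MvPolynomial.X (s, p.2))
  | scalar (c : ℂ) (k : ℕ) :
      Rel (MvPolynomial.X (algebraMap ℂ R c, k) - MvPolynomial.C (if k = 0 then c else 0))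

/-- The coordinate ring `𝒪((Spec R)_∞)` of the arc space of `Spec R`. -/
abbrev CoordRing : Type _ := MvPolynomial (R × ℕ) ℂ ⧸ Ideal.span {f | Rel R f}

variable {R}

/-- The function `r_k` on the arc space: the coefficient of `t^k` of `r` along an arc. -/
def coeff (r : R) (k : ℕ) : CoordRing R := Ideal.Quotient.mk _ (MvPolynomial.X (r, k))

lemma coeff_add (r s : R) (k : ℕ) : coeff (r + s) k = coeff r k + coeff s k := by
  rw [coeff, coeff, coeff, ← map_add]
  exact Ideal.Quotient.eq.2 (Ideal.subset_span (Rel.add r s k))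

lemma coeff_mul (r s : R) (k : ℕ) :
    coeff (r * s) k = ∑ p ∈ Finset.HasAntidiagonal.antidiagonal k, coeff r p.1 * coeff s p.2 := by
  simp only [coeff, ← map_mul, ← map_sum]
  exact Ideal.Quotient.eq.2 (Ideal.subset_span (Rel.mul r s k))

lemma coeff_algebraMap (c : ℂ) (k : ℕ) :
    coeff (algebraMap ℂ R c) k = algebraMap ℂ (CoordRing R) (if k = 0 then c else 0) :=
  Ideal.Quotient.eq.2 (Ideal.subset_span (Rel.scalar c k))

variable (R) in
/-- The universal arc `R → 𝒪((Spec R)_∞)⟦t⟧`, `r ↦ ∑ r_k t^k`. -/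
def univ : R →ₐ[ℂ] (CoordRing R)⟦X⟧ where
  toFun r := PowerSeries.mk (coeff r)
  map_one' := by
    ext k
    have h := coeff_algebraMap (R := R) 1 k
    rw [map_one] at h
    rw [PowerSeries.coeff_mk, h, PowerSeries.coeff_one]
    split_ifs <;> simp
  map_zero' := by
    ext k
    have h := coeff_algebraMap (R := R) 0 k
    rw [map_zero] at h
    rw [PowerSeries.coeff_mk, h]
    simp
  map_add' r s := by ext k; simp [coeff_add]
  map_mul' r s := by ext k; simp [coeff_mul, PowerSeries.coeff_mul]
  commutes' c := by
    ext k
    rw [PowerSeries.coeff_mk, coeff_algebraMap, PowerSeries.algebraMap_apply,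
      PowerSeries.coeff_C]
    split_ifs <;> simp

variable {A : Type*} [CommRing A] [Algebra ℂ A]

/-- The `A`-point of the arc space defined by an arc `R → A⟦t⟧`; in other words, evaluation of
functions on the arc space at this arc.  It sends `r_k` to the `t^k`-coefficient of `γ r`. -/
def eval (γ : R →ₐ[ℂ] A⟦X⟧) : CoordRing R →ₐ[ℂ] A :=
  Ideal.Quotient.liftₐ _ (MvPolynomial.aeval fun p : R × ℕ => PowerSeries.coeff p.2 (γ p.1)) (by
    intro f hf
    rw [← RingHom.mem_ker]
    refine (Ideal.span_le (I := RingHom.ker _)).2 ?_ hf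
    rintro _ (⟨r, s, k⟩ | ⟨r, s, k⟩ | ⟨c, k⟩)
    · simp [RingHom.mem_ker]
    · simp [RingHom.mem_ker, PowerSeries.coeff_mul]
    · simp only [SetLike.mem_coe, RingHom.mem_ker, map_sub, MvPolynomial.aeval_X,
        AlgHom.commutes, PowerSeries.algebraMap_apply, PowerSeries.coeff_C, MvPolynomial.aeval_C]
      split_ifs <;> simp)

@[simp] lemma eval_coeff (γ : R →ₐ[ℂ] A⟦X⟧) (r : R) (k : ℕ) :
    eval γ (coeff r k) = PowerSeries.coeff k (γ r) := by
  refine (Ideal.Quotient.lift_mk _ _ _).trans ?_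
  simp

lemma algHom_ext {f g : CoordRing R →ₐ[ℂ] A} (h : ∀ r k, f (coeff r k) = g (coeff r k)) : f = g := by
  refine Ideal.Quotient.algHom_ext _ (MvPolynomial.algHom_ext fun p => ?_)
  exact h p.1 p.2

/-- The universal property of the arc space: `Hom(Spec A, (Spec R)_∞) ≅ Hom(Spec A⟦t⟧, Spec R)`. -/
def homEquiv : (CoordRing R →ₐ[ℂ] A) ≃ (R →ₐ[ℂ] A⟦X⟧) where
  toFun f := (PowerSeries.mapAlgHom f).comp (univ R)
  invFun := eval
  left_inv f := algHom_ext fun r k => by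
    simp [PowerSeries.mapAlgHom_apply, univ]
  right_inv γ := by
    ext r k
    simp [PowerSeries.mapAlgHom_apply, univ]

variable {S : Type*} [CommRing S] [Algebra ℂ S]

/-- Functoriality: the homomorphism `𝒪((Spec R)_∞) → 𝒪((Spec S)_∞)` induced by the morphism
`Spec S → Spec R` dual to `φ : R → S`.  It sends `r_k` to `(φ r)_k`. -/
def map (φ : R →ₐ[ℂ] S) : CoordRing R →ₐ[ℂ] CoordRing S := eval ((univ S).comp φ)

/-- The derivation of the polynomial ring in the symbols `r_k` with `r_k ↦ (k + 1) r_{k+1}`. -/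
def polyD : Derivation ℂ (MvPolynomial (R × ℕ) ℂ) (MvPolynomial (R × ℕ) ℂ) :=
  MvPolynomial.mkDerivation ℂ fun p : R × ℕ =>
    (p.2 + 1 : MvPolynomial (R × ℕ) ℂ) * MvPolynomial.X (p.1, p.2 + 1)

lemma mk_polyD_X (r : R) (k : ℕ) :
    (Ideal.Quotient.mkₐ ℂ (Ideal.span {f | Rel R f})) (polyD (MvPolynomial.X (r, k))) =
      PowerSeries.coeff k (PowerSeries.derivative (CoordRing R) (univ R r)) := by
  rw [PowerSeries.coeff_derivative, polyD, MvPolynomial.mkDerivation_X]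
  simp [univ, coeff, mul_comm]

lemma sum_swap_aux {B : Type*} [CommRing B] (a : B) (u v : ℕ → B) (k : ℕ) :
    a + ∑ p ∈ Finset.HasAntidiagonal.antidiagonal k, u p.1 * v p.2 -
      (a + ∑ p ∈ Finset.HasAntidiagonal.antidiagonal k, u p.2 * v p.1) = 0 := by
  rw [← Finset.Nat.sum_antidiagonal_swap (f := fun p : ℕ × ℕ => u p.2 * v p.1)]
  simp

/-- The ideal of relations is stable under `polyD`. -/
lemma mk_polyD_eq_zero (f : MvPolynomial (R × ℕ) ℂ)
    (hf : Ideal.Quotient.mkₐ ℂ (Ideal.span {f | Rel R f}) f = 0) :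
    Ideal.Quotient.mkₐ ℂ (Ideal.span {f | Rel R f}) (polyD f) = 0 := by
  have hf' : f ∈ Ideal.span {f | Rel R f} := Ideal.Quotient.eq_zero_iff_mem.1 hf
  clear hf
  induction hf' using Submodule.span_induction with
  | zero => simp
  | add x y _ _ hx hy => rw [map_add, map_add, hx, hy, add_zero]
  | smul a x hx h =>
    have hx0 : Ideal.Quotient.mkₐ ℂ (Ideal.span {f | Rel R f}) x = 0 :=
      Ideal.Quotient.eq_zero_iff_mem.2 hx
    rw [smul_eq_mul, Derivation.leibniz, map_add, smul_eq_mul, smul_eq_mul, map_mul, map_mul, h,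
      hx0, mul_zero, zero_mul, add_zero]
  | mem x hx =>
    obtain ⟨r, s, k⟩ | ⟨r, s, k⟩ | ⟨c, k⟩ := hx
    · simp only [map_sub, map_add, mk_polyD_X]
      simp
    · have hc (r : R) (k : ℕ) : Ideal.Quotient.mkₐ ℂ (Ideal.span {f | Rel R f})
          (MvPolynomial.X (r, k)) = PowerSeries.coeff k (univ R r) := by
        simp [univ, coeff]
      simp only [map_sub, map_sum, Derivation.leibniz, smul_eq_mul, map_add, map_mul, mk_polyD_X,
        hc, PowerSeries.coeff_mul, Finset.sum_add_distrib]
      exact sum_swap_aux _ (fun i => PowerSeries.coeff i (univ R s))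
        (fun i => PowerSeries.coeff i (PowerSeries.derivative (CoordRing R) (univ R r))) k
    · have h := (univ R).commutes c
      simp only [map_sub, mk_polyD_X]
      rw [h]
      simp [polyD, PowerSeries.algebraMap_apply]

variable (R) in
/-- The natural derivation `D` of the coordinate ring of the arc space,
`D r_k = (k + 1) r_{k+1}`; thus `r_k = (1 / k!) D^k r_0`. -/
def D : Derivation ℂ (CoordRing R) (CoordRing R) :=
  Derivation.liftOfSurjective (f := Ideal.Quotient.mkₐ ℂ (Ideal.span {f | Rel R f}))
    (Ideal.Quotient.mkₐ_surjective ℂ _) mk_polyD_eq_zero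

@[simp] lemma D_coeff (r : R) (k : ℕ) :
    D R (coeff r k) = ((k : CoordRing R) + 1) * coeff r (k + 1) := by
  have h := Derivation.liftOfSurjective_apply
    (f := Ideal.Quotient.mkₐ ℂ (Ideal.span {f | Rel R f}))
    (Ideal.Quotient.mkₐ_surjective ℂ _) mk_polyD_eq_zero (MvPolynomial.X (r, k))
  refine h.trans ?_
  simp [coeff, polyD, MvPolynomial.mkDerivation_X]

/-- The differential subalgebra generated by a set `s`: the smallest subalgebra that contains `s`
and is stable under `D`. -/
def diffAdjoin (s : Set (CoordRing R)) : Subalgebra ℂ (CoordRing R) :=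
  sInf {B | s ⊆ B ∧ ∀ f ∈ B, D R f ∈ B}

end Arc

/-! ### `SL_n` acting on `V = ℓ ℂ^n`

An `A`-point of `V` is an `n × ℓ` matrix with entries in `A`, whose columns are the `ℓ` vectors, and
`SL_n(A)` acts by multiplication from the left. -/

namespace SLInv

variable (n l : ℕ)

/-- The coordinate ring `𝒪(V)` of `V = ℓ ℂ^n`; the variable `(i, j)` is the `i`-th coordinate on the
`j`-th copy of `ℂ^n`. -/
abbrev OV : Type := MvPolynomial (Fin n × Fin l) ℂ

variable {n l}

/-- The homomorphism `𝒪(V) → A` which evaluates polynomials at an `A`-point of `V`. -/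
def point {A : Type*} [CommRing A] [Algebra ℂ A] (M : Matrix (Fin n) (Fin l) A) :
    OV n l →ₐ[ℂ] A :=
  MvPolynomial.aeval fun p => M p.1 p.2

variable (n l)

/-- The ring of invariants `𝒪(V)^G` of the algebraic group `G = SL_n`: the functions `f` on `V` with
`f (g v) = f v` for all points `g` of `G` and `v` of `V` in every commutative `ℂ`-algebra `A`. -/
def invariants : Subalgebra ℂ (OV n l) where
  carrier := {f | ∀ (A : Type) [CommRing A] [Algebra ℂ A]
    (g : Matrix.SpecialLinearGroup (Fin n) A) (M : Matrix (Fin n) (Fin l) A),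
    point (g.1 * M) f = point M f}
  mul_mem' hf hf' A _ _ g M := by simp only [map_mul, hf A g M, hf' A g M]
  add_mem' hf hf' A _ _ g M := by simp only [map_add, hf A g M, hf' A g M]
  algebraMap_mem' c A _ _ g M := by simp only [AlgHom.commutes]

/-- The ring of invariants `𝒪(V_∞)^{G_∞}` of the arc group `G_∞`: for a commutative `ℂ`-algebra `A`,
`G_∞(A) = SL_n(A⟦t⟧)`, the points `V_∞(A)` are the `n × ℓ` matrices with entries in `A⟦t⟧`, and a
function `f` on `V_∞` is invariant if `f (g v) = f v` for all such `A`, `g` and `v`. -/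
def arcInvariants : Subalgebra ℂ (Arc.CoordRing (OV n l)) where
  carrier := {f | ∀ (A : Type) [CommRing A] [Algebra ℂ A]
    (g : Matrix.SpecialLinearGroup (Fin n) A⟦X⟧) (M : Matrix (Fin n) (Fin l) A⟦X⟧),
    Arc.eval (point (g.1 * M)) f = Arc.eval (point M) f}
  mul_mem' hf hf' A _ _ g M := by simp only [map_mul, hf A g M, hf' A g M]
  add_mem' hf hf' A _ _ g M := by simp only [map_add, hf A g M, hf' A g M]
  algebraMap_mem' c A _ _ g M := by simp only [AlgHom.commutes]

/-- The homomorphism `p_∞^* : 𝒪(Z_∞) → 𝒪(V_∞)` induced on arc spaces by the quotient morphism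
`p : V → Z = Spec 𝒪(V)^G`, which is dual to the inclusion `𝒪(V)^G ⊆ 𝒪(V)`. -/
def pStar : Arc.CoordRing (invariants n l) →ₐ[ℂ] Arc.CoordRing (OV n l) :=
  Arc.map (invariants n l).val

variable {n l}

/-- The determinant `[x^{(c 1)}, …, x^{(c n)}] ∈ 𝒪(V)` of the copies `c 1, …, c n` of `ℂ^n`. -/
def bracket (c : Fin n → Fin l) : OV n l :=
  (Matrix.of fun i k : Fin n => (MvPolynomial.X (i, c k) : OV n l)).det

end SLInv

end

/-! Let `f` be an arc invariant. Testing invariance on the group elements `1 + ε t^a H` with `tr H =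
0` over dual numbers shows that the current algebra `sl_n[t]` kills `f` (`currentDer_eq_zero`).
Polarize the part of `f` of degree `m` and fix the copies `c_1, …, c_m` of `ℂ^n` that occur. What
remains is an invariant functional on the `m`-th tensor power of `ℂ^n[t]`. It is written as linear
maps `F w` on `ℂ[X_1, …, X_m]`, one for each word `w` of row indices, where the exponent of `X_p` is
the power of `t` in the `p`-th factor. `IsBalanced` records what is used of the invariance: raising
operators, Cartan currents, weight.

Every map `π` from the `m` positions to `N = m / n` blocks with fibres of size `n` gives a balanced
family `blockEval π` with values in `ℂ[Y_1, …, Y_N]`: a product of `n × n` determinants, the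
positions of block `b` sharing the variable `Y_b`. The core is `IsBalanced.exists_eq_sum`: every
balanced family factors through these. Read back in terms of `f`, a functional of `blockEval π` is a
combination of products of coefficients of maximal minors (`sum_blockEval_mem_detAlg`).

The core is a count. Modulo the relations that all balanced families satisfy, the space of words is
spanned over the algebra of Cartan currents by one element for each `π`
(`relations_sup_range_blockSpan`). At a point with distinct coordinates the evaluations separate the
`π`. Hence the square matrix of evaluations of the spanning elements has nonzero determinant
(`det_blockMatrix_ne_zero`), and the evaluations are jointly injective modulo the relations
(`ker_totalEval_le`).

For the spanning statement, induction on the degree (`IsBalanced.eq_zero`) reduces to families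
killed by all Cartan currents of positive degree, as for local Weyl modules. There `IsLocal.eq_zero`
strips off the last position, filtering by its letter `j` and by the exponent of its variable.
Garland's identity (`IsLocal.pow_mul_eq_zero`) bounds that exponent by the number of blocks of size
`j + 1`, so the pairs of a letter and an exponent correspond to the blocks that can lose their last
element.

The determinants are invariant, which gives the other inclusion. The differential statement follows
from `D r_k = (k + 1) r_{k+1}` and invertibility of `k + 1`. -/

noncomputable section

namespace ArcInv

open Function (update)

/-! ### Functions on the subsets of fixed size of a finite set -/

section Combinatorics

variable {ι W : Type*} [DecidableEq ι] [AddCommGroup W] [Module ℂ W]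

/-- Sums of a function over the sets meeting `B` in `k` and `k + 1` elements are proportional, if
all sums over the one-point extensions of a set vanish. -/
lemma sum_inter_card_eq_zero (Y B : Finset ι) (v : Finset ι → W)
    (h : ∀ L ⊆ Y, L.card + 1 = B.card → ∑ p ∈ Y \ L, v (insert p L) = 0)
    (h0 : ∀ X ⊆ Y \ B, X.card = B.card → v X = 0) (k : ℕ) (hk : k ≤ B.card) :
    ∑ X ∈ Y.powersetCard B.card with (X ∩ B).card = k, v X = 0 := by
  induction k with
  | zero =>
    refine Finset.sum_eq_zero fun X hX => ?_
    simp only [Finset.mem_filter, Finset.mem_powersetCard, Finset.card_eq_zero] at hX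
    refine h0 X ?_ hX.1.2
    rw [Finset.subset_sdiff]
    exact ⟨hX.1.1, Finset.disjoint_iff_inter_eq_empty.2 hX.2⟩
  | succ k ih =>
    have ih := ih (by omega)
    obtain ⟨c, hc⟩ : ∃ c, B.card = c + 1 := ⟨B.card - 1, by omega⟩
    have h1 : ∑ L ∈ Y.powersetCard c with (L ∩ B).card = k, ∑ p ∈ Y \ L, v (insert p L) = 0 := by
      refine Finset.sum_eq_zero fun L hL => ?_
      simp only [Finset.mem_filter, Finset.mem_powersetCard] at hL
      exact h L hL.1.1 (by omega)
    have h2 : ∑ L ∈ Y.powersetCard c with (L ∩ B).card = k, ∑ p ∈ Y \ L, v (insert p L) =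
        ∑ X ∈ Y.powersetCard B.card, ∑ p ∈ X with ((X.erase p) ∩ B).card = k, v X := by
      rw [Finset.sum_sigma', Finset.sum_sigma']
      refine Finset.sum_bij' (fun a _ => ⟨insert a.2 a.1, a.2⟩) (fun a _ => ⟨a.1.erase a.2, a.2⟩)
        ?_ ?_ ?_ ?_ ?_
      · rintro ⟨L, p⟩ ha
        simp only [Finset.mem_sigma, Finset.mem_filter, Finset.mem_powersetCard,
          Finset.mem_sdiff] at ha ⊢
        refine ⟨⟨Finset.insert_subset ha.2.1 ha.1.1.1, ?_⟩, Finset.mem_insert_self _ _, ?_⟩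
        · rw [Finset.card_insert_of_notMem ha.2.2]; omega
        · rw [Finset.erase_insert ha.2.2]; exact ha.1.2
      · rintro ⟨X, p⟩ ha
        simp only [Finset.mem_sigma, Finset.mem_filter, Finset.mem_powersetCard,
          Finset.mem_sdiff] at ha ⊢
        refine ⟨⟨⟨(Finset.erase_subset _ _).trans ha.1.1, ?_⟩, ha.2.2⟩, ha.1.1 ha.2.1,
          Finset.notMem_erase _ _⟩
        rw [Finset.card_erase_of_mem ha.2.1]; omega
      · rintro ⟨L, p⟩ ha
        simp only [Finset.mem_sigma, Finset.mem_sdiff] at ha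
        simp [Finset.erase_insert ha.2.2]
      · rintro ⟨X, p⟩ ha
        simp only [Finset.mem_sigma, Finset.mem_filter] at ha
        simp [Finset.insert_erase ha.2.1]
      · rintro ⟨L, p⟩ ha
        rfl
    have h3 : ∀ X ∈ Y.powersetCard B.card, ∑ p ∈ X with ((X.erase p) ∩ B).card = k, v X =
        (if (X ∩ B).card = k + 1 then ((k + 1 : ℕ) : ℂ) • v X else 0) +
        (if (X ∩ B).card = k then ((B.card - k : ℕ) : ℂ) • v X else 0) := by
      intro X hX
      rw [Finset.mem_powersetCard] at hX
      have e : ∀ p, (X.erase p) ∩ B = (X ∩ B).erase p := fun p => Finset.erase_inter _ _ _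
      rw [Finset.sum_const, ← Nat.cast_smul_eq_nsmul ℂ]
      by_cases h1 : (X ∩ B).card = k + 1
      · rw [if_pos h1, if_neg (by omega), add_zero]
        congr 3
        rw [← h1]
        congr 1
        ext p
        simp only [Finset.mem_filter, Finset.mem_inter, e]
        constructor
        · rintro ⟨hp, hpk⟩
          refine ⟨hp, ?_⟩
          by_contra hpB
          rw [Finset.erase_eq_of_notMem (by simp [hpB])] at hpk
          omega
        · rintro ⟨hp, hpB⟩
          refine ⟨hp, ?_⟩
          rw [Finset.card_erase_of_mem (by simp [hp, hpB])]
          omega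
      · by_cases h2 : (X ∩ B).card = k
        · rw [if_neg h1, if_pos h2, zero_add]
          congr 2
          have : {p ∈ X | ((X.erase p) ∩ B).card = k} = X \ (X ∩ B) := by
            ext p
            simp only [Finset.mem_filter, Finset.mem_inter, e, Finset.mem_sdiff, not_and]
            constructor
            · rintro ⟨hp, hpk⟩
              refine ⟨hp, fun _ hpB => ?_⟩
              rw [Finset.card_erase_of_mem (by simp [hp, hpB])] at hpk
              have : 0 < (X ∩ B).card := Finset.card_pos.2 ⟨p, by simp [hp, hpB]⟩
              omega
            · rintro ⟨hp, hpB⟩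
              refine ⟨hp, ?_⟩
              rw [Finset.erase_eq_of_notMem (by simp [hpB hp])]
              exact h2
          rw [this, Finset.card_sdiff_of_subset Finset.inter_subset_left, h2, hX.2]
        · rw [if_neg h1, if_neg h2, add_zero]
          have : {p ∈ X | ((X.erase p) ∩ B).card = k} = ∅ := by
            rw [Finset.filter_eq_empty_iff]
            intro p hp hpk
            rw [e] at hpk
            have := Finset.pred_card_le_card_erase (s := X ∩ B) (a := p)
            have := Finset.card_erase_le (s := X ∩ B) (a := p)
            omega
          rw [this, Finset.card_empty, Nat.cast_zero, zero_smul]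
    rw [h2, Finset.sum_congr rfl h3, Finset.sum_add_distrib, ← Finset.sum_filter,
      ← Finset.sum_filter, ← Finset.smul_sum, ← Finset.smul_sum, ih, smul_zero, add_zero] at h1
    exact (smul_eq_zero.1 h1).resolve_left (Nat.cast_ne_zero.2 (Nat.succ_ne_zero k))

/-- The case `k = B.card` of the preceding lemma: `B` is the only set of its size that meets `B` in
all of `B`. -/
lemma eq_zero_of_sum_insert (Y B : Finset ι) (hB : B ⊆ Y) (v : Finset ι → W)
    (h : ∀ L ⊆ Y, L.card + 1 = B.card → ∑ p ∈ Y \ L, v (insert p L) = 0)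
    (h0 : ∀ X ⊆ Y \ B, X.card = B.card → v X = 0) : v B = 0 := by
  have h1 := sum_inter_card_eq_zero Y B v h h0 B.card le_rfl
  rwa [Finset.sum_eq_single_of_mem B (by simp [hB])] at h1
  intro X hX hXB
  simp only [Finset.mem_filter, Finset.mem_powersetCard] at hX
  exfalso
  refine hXB (Finset.eq_of_subset_of_card_le ?_ hX.1.2.le).symm
  rw [← Finset.inter_eq_right]
  exact Finset.eq_of_subset_of_card_le Finset.inter_subset_right hX.2.ge

end Combinatorics

/-! ### Power sums and generating series -/

section PowerSums

variable {ι A : Type*} [CommRing A]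

/-- The geometric series `1 / (1 + a T)`. -/
def geom (a : A) : A⟦X⟧ := PowerSeries.mk fun k => (-a) ^ k

lemma one_add_mul_geom (a : A) : (1 + PowerSeries.C a * PowerSeries.X) * geom a = 1 := by
  ext k
  rw [add_mul, one_mul, mul_assoc, map_add, PowerSeries.coeff_C_mul, PowerSeries.coeff_one]
  cases k with
  | zero => simp [geom]
  | succ k => rw [PowerSeries.coeff_succ_X_mul]; simp [geom, pow_succ, mul_comm]

/-- Newton's identities in characteristic zero: the coefficients of the logarithmic derivative are,
up to sign, the power sums, so the product has derivative `0` and constant term `1`. -/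
lemma prod_one_add_eq_one [Algebra ℂ A] (S : Finset ι) (t : ι → A)
    (h : ∀ a : ℕ, ∑ p ∈ S, t p ^ (a + 1) = 0) :
    ∏ p ∈ S, (1 + PowerSeries.C (t p) * PowerSeries.X) = (1 : A⟦X⟧) := by
  classical
  have hQ : IsAddTorsionFree A := by
    have : Module ℚ A := Module.compHom A (algebraMap ℚ ℂ)
    exact IsAddTorsionFree.of_module_rat A
  have hd : PowerSeries.derivative A (∏ p ∈ S, (1 + PowerSeries.C (t p) * PowerSeries.X)) =
      (∏ p ∈ S, (1 + PowerSeries.C (t p) * PowerSeries.X)) *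
        ∑ p ∈ S, PowerSeries.C (t p) * geom (t p) := by
    have h1 : ∀ p, PowerSeries.derivative A (1 + PowerSeries.C (t p) * PowerSeries.X) =
        PowerSeries.C (t p) := by
      intro p
      ext k
      rw [PowerSeries.coeff_derivative]
      cases k <;> simp [PowerSeries.coeff_C, PowerSeries.coeff_one]
    clear h
    induction S using Finset.induction_on with
    | empty => simp
    | insert p S hp ih =>
      rw [Finset.prod_insert hp, Derivation.leibniz, ih, h1, Finset.sum_insert hp, smul_eq_mul,
        smul_eq_mul]
      linear_combination (-PowerSeries.C (t p) *
        ∏ x ∈ S, (1 + PowerSeries.C (t x) * PowerSeries.X)) * one_add_mul_geom (t p)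
  have hz : ∑ p ∈ S, PowerSeries.C (t p) * geom (t p) = 0 := by
    ext k
    simp only [map_sum, PowerSeries.coeff_C_mul, geom, PowerSeries.coeff_mk, map_zero]
    have : ∀ p ∈ S, t p * (-t p) ^ k = (-1) ^ k * t p ^ (k + 1) := fun p _ => by
      rw [neg_pow, pow_succ]; ring
    rw [Finset.sum_congr rfl this, ← Finset.mul_sum, h, mul_zero]
  refine PowerSeries.derivative.ext ?_ ?_
  · rw [hd, hz, mul_zero]; simp
  · simp [map_prod]

lemma coeff_prod_one_add_eq_zero (S : Finset ι) (t : ι → A) (s : ℕ) (h : S.card < s) :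
    PowerSeries.coeff s (∏ p ∈ S, (1 + PowerSeries.C (t p) * PowerSeries.X)) = 0 := by
  have : ∏ p ∈ S, (1 + PowerSeries.C (t p) * PowerSeries.X) =
      ((∏ p ∈ S, (1 + Polynomial.C (t p) * Polynomial.X) : Polynomial A) : A⟦X⟧) := by
    rw [← Polynomial.coeToPowerSeries.ringHom_apply, map_prod]
    simp
  rw [this, Polynomial.coeff_coe]
  refine Polynomial.coeff_eq_zero_of_natDegree_lt (lt_of_le_of_lt ?_ h)
  refine (Polynomial.natDegree_prod_le _ _).trans ?_
  refine (Finset.sum_le_card_nsmul _ _ 1 fun p _ => ?_).trans (by simp)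
  compute_degree

end PowerSums

/-! ### Local families and Garland's identity -/

section

variable {m : ℕ} {W : Type*} [AddCommGroup W] [Module ℂ W]

/-- Families of linear functionals, indexed by words, which vanish on the images of the raising
operators and of the positive part of the Cartan currents acting on the first `r` letters. -/
structure IsLocal (r : ℕ) (F : (Fin m → ℕ) → MvPolynomial (Fin m) ℂ →ₗ[ℂ] W) : Prop where
  raise : ∀ i j, i < j → ∀ (w : Fin m → ℕ) (a : ℕ) (g : MvPolynomial (Fin m) ℂ),
    ∑ p with p.val < r ∧ w p = i, F (update w p j) (MvPolynomial.X p ^ a * g) = 0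
  cartan : ∀ (j a : ℕ) (w : Fin m → ℕ) (g : MvPolynomial (Fin m) ℂ),
    ∑ p with p.val < r ∧ w p = j, F w (MvPolynomial.X p ^ (a + 1) * g) = 0

/-- The polynomials which annihilate a linear map. -/
def annIdeal (f : MvPolynomial (Fin m) ℂ →ₗ[ℂ] W) : Ideal (MvPolynomial (Fin m) ℂ) where
  carrier := {q | ∀ g, f (q * g) = 0}
  zero_mem' g := by simp
  add_mem' hq hq' g := by rw [add_mul, map_add, hq g, hq' g, add_zero]
  smul_mem' c q hq g := by rw [smul_eq_mul, mul_comm c, mul_assoc]; exact hq _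

lemma mem_annIdeal {f : MvPolynomial (Fin m) ℂ →ₗ[ℂ] W} {q : MvPolynomial (Fin m) ℂ} :
    q ∈ annIdeal f ↔ ∀ g, f (q * g) = 0 := Iff.rfl

/-- The coefficient of `T ^ s` in `∏_{p ∈ Z} (1 + X_p T) / ∏_{p ∈ X} (1 + X_p T)`. -/
def quotCoeff (s : ℕ) (Z X : Finset (Fin m)) : MvPolynomial (Fin m) ℂ :=
  PowerSeries.coeff s ((∏ p ∈ Z, (1 + PowerSeries.C (MvPolynomial.X p) * PowerSeries.X)) *
    ∏ p ∈ X, geom (MvPolynomial.X p))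

/-- The factors over `X` cancel and leave a polynomial in `T` of degree at most `Z.card - X.card <
s`. -/
lemma quotCoeff_eq_zero (s : ℕ) (Z X : Finset (Fin m)) (hX : X ⊆ Z) (h : Z.card < s + X.card) :
    quotCoeff s Z X = 0 := by
  have h1 : (∏ p ∈ X, (1 + PowerSeries.C (MvPolynomial.X p) * PowerSeries.X)) *
      ∏ p ∈ X, geom (MvPolynomial.X p : MvPolynomial (Fin m) ℂ) = 1 := by
    rw [← Finset.prod_mul_distrib]
    exact Finset.prod_eq_one fun p _ => one_add_mul_geom _
  rw [quotCoeff, ← Finset.prod_sdiff hX, mul_assoc, h1, mul_one]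
  apply coeff_prod_one_add_eq_zero
  have := Finset.card_le_card hX
  rw [Finset.card_sdiff_of_subset hX]
  omega

/-- Expands the factor `1 / (1 + X_p T)`. Apart from powers of `X_p` the result does not depend on
`p`, which is the shape that `IsLocal.raise` needs. -/
lemma quotCoeff_insert (s : ℕ) (Z L : Finset (Fin m)) (p : Fin m) (hp : p ∉ L) :
    quotCoeff s Z (insert p L) = ∑ k ∈ Finset.HasAntidiagonal.antidiagonal s,
      MvPolynomial.X p ^ k.2 * ((-1) ^ k.2 * quotCoeff k.1 Z L) := by
  rw [quotCoeff, Finset.prod_insert hp, mul_left_comm, mul_comm (geom _), PowerSeries.coeff_mul]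
  refine Finset.sum_congr rfl fun k _ => ?_
  rw [geom, PowerSeries.coeff_mk, neg_pow, ← quotCoeff]
  ring

/-- In `A` the product over `X` is `1` and the product over `Z` is `1 / (1 + X_p T)`, whose
coefficients are the powers of `-X_p`. -/
lemma map_quotCoeff {A : Type*} [CommRing A] (f : MvPolynomial (Fin m) ℂ →+* A) (s : ℕ)
    (Z X : Finset (Fin m)) (p : Fin m) (hp : p ∉ Z)
    (hZ : ∏ q ∈ insert p Z, (1 + PowerSeries.C (f (MvPolynomial.X q)) * PowerSeries.X) = (1 : A⟦X⟧))
    (hX : ∏ q ∈ X, (1 + PowerSeries.C (f (MvPolynomial.X q)) * PowerSeries.X) = (1 : A⟦X⟧)) :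
    f (MvPolynomial.X p) ^ s = (-1) ^ s * f (quotCoeff s Z X) := by
  have hg : ∀ q : Fin m, PowerSeries.map f (geom (MvPolynomial.X q)) =
      geom (f (MvPolynomial.X q)) := fun q => by ext k; simp [geom]
  have h1 : ∏ q ∈ X, geom (f (MvPolynomial.X q)) = 1 := by
    have h := Finset.prod_congr (M := A⟦X⟧) (s₁ := X) rfl
      fun q _ => one_add_mul_geom (f (MvPolynomial.X q))
    rwa [Finset.prod_mul_distrib, hX, one_mul, Finset.prod_const_one] at h
  rw [Finset.prod_insert hp] at hZ
  have h2 : ∏ q ∈ Z, (1 + PowerSeries.C (f (MvPolynomial.X q)) * PowerSeries.X) =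
      geom (f (MvPolynomial.X p)) := by
    linear_combination (geom (f (MvPolynomial.X p))) * hZ -
      (∏ q ∈ Z, (1 + PowerSeries.C (f (MvPolynomial.X q)) * PowerSeries.X)) *
        one_add_mul_geom (f (MvPolynomial.X p))
  rw [quotCoeff, ← PowerSeries.coeff_map, map_mul, map_prod, map_prod]
  simp only [hg, map_add, map_one, map_mul, PowerSeries.map_C, PowerSeries.map_X]
  rw [h1, h2, mul_one, geom, PowerSeries.coeff_mk, ← mul_pow, neg_one_mul, neg_neg]

/-- A form of Garland's identity: on a highest weight vector for the current algebra of `sl_2` the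
current of the lowering operator of large degree vanishes. -/
lemma IsLocal.pow_mul_eq_zero {r : ℕ} {F : (Fin m → ℕ) → MvPolynomial (Fin m) ℂ →ₗ[ℂ] W}
    (hF : IsLocal (r + 1) F) (P : Fin m) (hP : P.val = r) (j : ℕ)
    (hj : ∀ w, j < w P → F w = 0) (w : Fin m → ℕ) (hw : w P = j) (s : ℕ)
    (hs : Finset.card {p : Fin m | p.val < r ∧ w p = j} <
      s + Finset.card {p : Fin m | p.val < r ∧ w p = j + 1})
    (g : MvPolynomial (Fin m) ℂ) : F w (MvPolynomial.X P ^ s * g) = 0 := by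
  classical
  set Z : Finset (Fin m) := {p : Fin m | p.val < r ∧ w p = j} with hZ
  set B : Finset (Fin m) := {p : Fin m | p.val < r ∧ w p = j + 1} with hB
  have hdisj : Disjoint Z B := by
    rw [Finset.disjoint_left]
    intro p hp hp'
    simp only [hZ, hB, Finset.mem_filter] at hp hp'
    omega
  have hPY : P ∉ Z ∪ B := by simp [hZ, hB, hP]
  -- The words obtained from `w` by redistributing the letters `j` and `j + 1` among the positions
  -- before `P`; `X` is the set of positions of `j + 1`.
  let wd : Finset (Fin m) → Fin m → ℕ := fun X p =>
    if p ∈ Z ∪ B then (if p ∈ X then j + 1 else j) else w p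
  have hwB : wd B = w := by
    funext p
    by_cases hp : p ∈ B
    · have hp' := hp
      simp only [hB, Finset.mem_filter] at hp'
      simp [wd, hp, hp'.2]
    · by_cases hpZ : p ∈ Z
      · have hp' := hpZ
        simp only [hZ, Finset.mem_filter] at hp'
        simp [wd, hp, hpZ, hp'.2]
      · simp [wd, hp, hpZ]
  -- For `X ⊆ Z` the coefficient itself vanishes by degree. The raising relations from `j` to `j +
  -- 1` carry this vanishing over to `X = B`.
  have key : ∀ g, F w (quotCoeff s Z B * g) = 0 := by
    intro g
    have h := eq_zero_of_sum_insert (Z ∪ B) B Finset.subset_union_right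
      (fun X => F (wd X) (quotCoeff s Z X * g)) ?_ ?_
    · simpa only [hwB] using h
    · intro L hL _
      have h1 : ∀ p ∈ (Z ∪ B) \ L, F (wd (insert p L)) (quotCoeff s Z (insert p L) * g) =
          ∑ k ∈ Finset.HasAntidiagonal.antidiagonal s, F (update (wd L) p (j + 1))
            (MvPolynomial.X p ^ k.2 * ((-1) ^ k.2 * quotCoeff k.1 Z L * g)) := by
        intro p hp
        rw [Finset.mem_sdiff] at hp
        have hu : wd (insert p L) = update (wd L) p (j + 1) := by
          funext q
          by_cases hq : q = p
          · subst hq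
            simp only [wd, hp.1, Finset.mem_insert_self, if_true, Function.update_self]
          · simp [wd, hq, Function.update_of_ne]
        rw [hu, quotCoeff_insert s Z L p hp.2, Finset.sum_mul, map_sum]
        simp only [mul_assoc]
      rw [Finset.sum_congr rfl h1, Finset.sum_comm]
      refine Finset.sum_eq_zero fun k _ => ?_
      have h2 := hF.raise j (j + 1) (Nat.lt_succ_self j) (wd L) k.2
        ((-1) ^ k.2 * quotCoeff k.1 Z L * g)
      have h3 : ({p : Fin m | p.val < r + 1 ∧ wd L p = j} : Finset (Fin m)) =
          insert P ((Z ∪ B) \ L) := by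
        ext p
        simp only [Finset.mem_filter, Finset.mem_univ, true_and, Finset.mem_insert,
          Finset.mem_sdiff]
        by_cases hpP : p = P
        · subst hpP
          simp only [wd, hPY, if_false, hw, hP, true_or, and_self, Nat.lt_succ_self]
        · have hlt : p.val < r + 1 ↔ p.val < r := by
            have : p.val ≠ r := fun h => hpP (Fin.ext (h.trans hP.symm))
            omega
          rw [hlt]
          by_cases hpY : p ∈ Z ∪ B
          · have : p.val < r := by
              simp only [hZ, hB, Finset.mem_union, Finset.mem_filter] at hpY
              omega
            by_cases hpL : p ∈ L <;> simp only [wd, hpY, hpL, this, hpP, if_true, if_false] <;> simp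
          · have : ¬(p.val < r ∧ w p = j) := fun h => hpY (by simp [hZ, h])
            simp only [wd, hpY, if_false, this, hpP, false_and, or_false]
      -- Position `P` also has letter `j`, but raising it gives a word with last letter above `j`,
      -- which `hj` kills.
      rw [h3, Finset.sum_insert (fun h => hPY (Finset.mem_sdiff.1 h).1), hj, LinearMap.zero_apply,
        zero_add] at h2
      · exact h2
      · simp
    · intro X hX hXc
      have hX : X ⊆ Z := by
        rwa [Finset.union_sdiff_cancel_right hdisj] at hX
      rw [quotCoeff_eq_zero s Z X hX (by omega), zero_mul, map_zero]
  -- Modulo the annihilator of `F w` the Cartan relations say that the power sums over the positions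
  -- of each letter vanish, so `quotCoeff s Z B` becomes `± X_P ^ s`.
  let q := Ideal.Quotient.mkₐ ℂ (annIdeal (F w))
  have hq : ∀ x, q x = 0 ↔ x ∈ annIdeal (F w) := fun x => Ideal.Quotient.eq_zero_iff_mem
  have hps : ∀ (i : ℕ) (a : ℕ),
      ∑ p ∈ ({p : Fin m | p.val < r + 1 ∧ w p = i} : Finset (Fin m)),
        q (MvPolynomial.X p) ^ (a + 1) = 0 := by
    intro i a
    simp only [← map_pow, ← map_sum]
    rw [hq, mem_annIdeal]
    intro g
    rw [Finset.sum_mul, map_sum]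
    exact hF.cartan i a w g
  have e1 : ({p : Fin m | p.val < r + 1 ∧ w p = j} : Finset (Fin m)) = insert P Z := by
    ext p
    simp only [hZ, Finset.mem_filter, Finset.mem_univ, true_and, Finset.mem_insert, Fin.ext_iff, hP]
    constructor
    · omega
    · rintro (h | h)
      · exact ⟨by omega, by rw [← hw]; congr 1; exact Fin.ext (h.trans hP.symm)⟩
      · exact ⟨by omega, h.2⟩
  have e2 : ({p : Fin m | p.val < r + 1 ∧ w p = j + 1} : Finset (Fin m)) = B := by
    ext p
    simp only [hB, Finset.mem_filter, Finset.mem_univ, true_and]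
    constructor
    · rintro ⟨h, h'⟩
      refine ⟨?_, h'⟩
      by_contra hc
      have : p = P := Fin.ext (by omega)
      subst this
      omega
    · omega
  have hZ1 := prod_one_add_eq_one _ (fun p => q (MvPolynomial.X p)) (hps j)
  have hB1 := prod_one_add_eq_one _ (fun p => q (MvPolynomial.X p)) (hps (j + 1))
  rw [e1] at hZ1
  rw [e2] at hB1
  have h1 := map_quotCoeff q.toRingHom s Z B P (fun h => hPY (Finset.mem_union_left _ h)) hZ1 hB1
  have h2 : q (quotCoeff s Z B) = 0 := (hq _).2 key
  have h3 : q (MvPolynomial.X P ^ s) = 0 := by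
    rw [map_pow]
    refine h1.trans ?_
    rw [show q.toRingHom (quotCoeff s Z B) = 0 from h2, mul_zero]
  exact (hq _).1 h3 g

end

/-! ### Spanning words and exponents for local families -/

section

variable {m N : ℕ} {W : Type*} [AddCommGroup W] [Module ℂ W]

/-- The word of a map `π` to a set of blocks: its letter at `p` counts the earlier elements of the
block of `p`. -/
def wordOf (π : Fin m → Fin N) (p : Fin m) : ℕ := Finset.card {q : Fin m | q < p ∧ π q = π p}

/-- The exponent of a map `π` to a set of blocks at `p`: the number of earlier blocks which have the
same number of elements `≤ p` as the block of `p`. -/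
def expOf (π : Fin m → Fin N) (p : Fin m) : ℕ :=
  Finset.card {b : Fin N | b < π p ∧ Finset.card {q : Fin m | q ≤ p ∧ π q = b} = wordOf π p + 1}

lemma wordOf_congr {π π' : Fin m → Fin N} {p : Fin m} (h : ∀ q ≤ p, π q = π' q) :
    wordOf π p = wordOf π' p := by
  unfold wordOf
  congr 1
  ext q
  simp only [Finset.mem_filter, Finset.mem_univ, true_and]
  refine and_congr_right fun hq => ?_
  rw [h q hq.le, h p le_rfl]

lemma expOf_congr {π π' : Fin m → Fin N} {p : Fin m} (h : ∀ q ≤ p, π q = π' q) :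
    expOf π p = expOf π' p := by
  unfold expOf
  rw [wordOf_congr h, h p le_rfl]
  congr 1
  ext b
  simp only [Finset.mem_filter, Finset.mem_univ, true_and]
  refine and_congr_right fun _ => ?_
  have : ({q : Fin m | q ≤ p ∧ π q = b} : Finset (Fin m)) =
      ({q : Fin m | q ≤ p ∧ π' q = b} : Finset (Fin m)) := by
    ext q
    simp only [Finset.mem_filter, Finset.mem_univ, true_and]
    exact and_congr_right fun hq => by rw [h q hq]
  rw [this]

/-- Sums over the first `r + 1` letters. -/
lemma sum_filter_lt_succ {V : Type*} [AddCommMonoid V] {r : ℕ} (P : Fin m) (hP : P.val = r)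
    (C : Fin m → Prop) [DecidablePred C] (f : Fin m → V) :
    ∑ p with p.val < r + 1 ∧ C p, f p =
      (if C P then f P else 0) + ∑ p with p.val < r ∧ C p, f p := by
  have hd : ∀ p : Fin m, p.val < r + 1 ↔ p = P ∨ p.val < r := fun p => by
    rw [Fin.ext_iff, hP]; omega
  split_ifs with h
  · rw [← Finset.sum_insert (by simp [hP])]
    refine Finset.sum_congr ?_ fun _ _ => rfl
    ext p
    simp only [Finset.mem_filter, Finset.mem_univ, true_and, Finset.mem_insert, hd]
    constructor
    · tauto
    · rintro (rfl | h') <;> tauto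
  · rw [zero_add]
    refine Finset.sum_congr ?_ fun _ _ => rfl
    ext p
    simp only [Finset.mem_filter, Finset.mem_univ, true_and, hd]
    constructor
    · rintro ⟨rfl | h', h''⟩ <;> tauto
    · tauto

lemma card_filter_lt_succ {r : ℕ} (P : Fin m) (hP : P.val = r)
    (C : Fin m → Prop) [DecidablePred C] :
    Finset.card {p : Fin m | p.val < r + 1 ∧ C p} =
      (if C P then 1 else 0) + Finset.card {p : Fin m | p.val < r ∧ C p} := by
  simp only [Finset.card_eq_sum_ones]
  exact sum_filter_lt_succ P hP C fun _ => 1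

lemma linearMap_eq_zero {ι : Type*} {f : MvPolynomial ι ℂ →ₗ[ℂ] W}
    (h : ∀ k, f (MvPolynomial.monomial k 1) = 0) : f = 0 :=
  (MvPolynomial.basisMonomials ι ℂ).ext fun k => by simp [h]

/-- The `κ`-th block of size `s`. -/
lemma exists_block (σ : Fin N → ℕ) (s κ : ℕ) (h : κ < Finset.card {b : Fin N | σ b = s}) :
    ∃ b, σ b = s ∧ Finset.card {c : Fin N | c < b ∧ σ c = s} = κ := by
  set S : Finset (Fin N) := {b : Fin N | σ b = s} with hS
  let e := S.orderEmbOfFin rfl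
  have he : ∀ i, σ (e i) = s := fun i =>
    (Finset.mem_filter.1 (S.orderEmbOfFin_mem rfl i)).2
  refine ⟨e ⟨κ, h⟩, he _, ?_⟩
  have h1 : ({c : Fin N | c < e ⟨κ, h⟩ ∧ σ c = s} : Finset (Fin N)) =
      (Finset.Iio (⟨κ, h⟩ : Fin S.card)).map e.toEmbedding := by
    ext c
    simp only [Finset.mem_filter, Finset.mem_univ, true_and, Finset.mem_map, Finset.mem_Iio]
    constructor
    · rintro ⟨hc, hc'⟩
      have hcS : c ∈ Set.range e := by
        rw [Finset.range_orderEmbOfFin]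
        simp [hS, hc']
      obtain ⟨i, rfl⟩ := hcS
      exact ⟨i, e.lt_iff_lt.1 hc, rfl⟩
    · rintro ⟨i, hi, rfl⟩
      exact ⟨e.lt_iff_lt.2 hi, he i⟩
  rw [h1, Finset.card_map, Fin.card_Iio]

lemma card_lt_eq_add (σ : Fin N → ℕ) (j : ℕ) :
    Finset.card {b : Fin N | j < σ b} =
      Finset.card {b : Fin N | σ b = j + 1} + Finset.card {b : Fin N | j + 1 < σ b} := by
  rw [← Finset.card_union_of_disjoint]
  · congr 1
    ext b
    simp only [Finset.mem_filter, Finset.mem_univ, true_and, Finset.mem_union]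
    omega
  · rw [Finset.disjoint_left]
    intro b hb hb'
    simp only [Finset.mem_filter, Finset.mem_univ, true_and] at hb hb'
    omega

/-- A local family whose words have a prescribed content is determined by its values at the words
and exponents of maps to a set of blocks. -/
theorem IsLocal.eq_zero [Nonempty (Fin m → Fin N)] (r : ℕ) (hr : r ≤ m) (σ : Fin N → ℕ)
    (F : (Fin m → ℕ) → MvPolynomial (Fin m) ℂ →ₗ[ℂ] W) (hF : IsLocal r F)
    (hc : ∀ w j, Finset.card {p : Fin m | p.val < r ∧ w p = j} ≠ Finset.card {b | j < σ b} →
      F w = 0)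
    (hv : ∀ π : Fin m → Fin N, (∀ b, Finset.card {p : Fin m | p.val < r ∧ π p = b} = σ b) →
      ∀ (w : Fin m → ℕ) (k : Fin m →₀ ℕ),
        (∀ p : Fin m, p.val < r → w p = wordOf π p ∧ k p = expOf π p) →
          F w (MvPolynomial.monomial k 1) = 0) :
    F = 0 := by
  induction r generalizing σ F with
  | zero =>
    funext w
    refine linearMap_eq_zero fun k => ?_
    by_cases h : ∀ b, σ b = 0
    · obtain ⟨π⟩ := (inferInstance : Nonempty (Fin m → Fin N))
      exact hv π (fun b => by simp [h b]) w k fun p hp => absurd hp (Nat.not_lt_zero _)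
    · push Not at h
      obtain ⟨b, hb⟩ := h
      rw [hc w 0, LinearMap.zero_apply]
      intro h
      simp only [Nat.not_lt_zero, false_and, Finset.filter_false, Finset.card_empty] at h
      have := Finset.card_eq_zero.1 h.symm
      rw [Finset.filter_eq_empty_iff] at this
      exact this (Finset.mem_univ b) (Nat.pos_of_ne_zero hb)
  | succ r ih =>
    obtain ⟨P, hP⟩ : ∃ P : Fin m, P.val = r := ⟨⟨r, by omega⟩, rfl⟩
    -- Downward induction on the letter at the last position `P`. No letter `≥ ∑ b, σ b` occurs in a
    -- word of the prescribed content.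
    suffices H : ∀ d w, ∑ b, σ b ≤ w P + d → F w = 0 from
      funext fun w => H (∑ b, σ b) w (by omega)
    intro d
    induction d with
    | zero =>
      intro w hw
      refine hc w (w P) fun h => ?_
      rw [card_filter_lt_succ P hP, if_pos rfl] at h
      have : ({b | w P < σ b} : Finset (Fin N)) = ∅ := by
        rw [Finset.filter_eq_empty_iff]
        intro b _ hb
        have := Finset.single_le_sum (f := σ) (fun _ _ => Nat.zero_le _) (Finset.mem_univ b)
        omega
      rw [this, Finset.card_empty] at h
      omega
    | succ d ihd =>
      intro w₀ hw₀
      by_cases hd : ∑ b, σ b ≤ w₀ P + d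
      · exact ihd w₀ hd
      obtain ⟨j, hj⟩ : ∃ j, w₀ P = j := ⟨_, rfl⟩
      have hjz : ∀ w, j < w P → F w = 0 := fun w hw => ihd w (by omega)
      -- Downward induction on the exponent `κ` of `X_P`, started by Garland's identity at the
      -- number of blocks of size `j + 1`.
      suffices H : ∀ e κ, Finset.card {b | σ b = j + 1} ≤ κ + e → ∀ w, w P = j → ∀ g,
          F w (MvPolynomial.X P ^ κ * g) = 0 by
        refine LinearMap.ext fun g => ?_
        simpa using H (Finset.card {b | σ b = j + 1}) 0 (by simp) w₀ hj g
      intro e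
      induction e with
      | zero =>
        intro κ hκ w hw g
        by_cases hcw : ∀ i, Finset.card {p : Fin m | p.val < r + 1 ∧ w p = i} =
            Finset.card {b | i < σ b}
        · refine hF.pow_mul_eq_zero P hP j hjz w hw κ ?_ g
          have h1 := hcw j
          have h2 := hcw (j + 1)
          rw [card_filter_lt_succ P hP, if_pos hw, card_lt_eq_add σ j] at h1
          rw [card_filter_lt_succ P hP, if_neg (by omega)] at h2
          omega
        · push Not at hcw
          obtain ⟨i, hi⟩ := hcw
          rw [hc w i hi, LinearMap.zero_apply]
      | succ e ihe =>
        intro κ hκ w hw g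
        by_cases he : Finset.card {b | σ b = j + 1} ≤ κ + e
        · exact ihe κ he w hw g
        have hz : ∀ w, w P = j → ∀ a g, F w (MvPolynomial.X P ^ (κ + (a + 1)) * g) = 0 :=
          fun w hw a g => ihe (κ + (a + 1)) (by omega) w hw g
        -- The pair `(j, κ)` designates the block that contains `P` as its last element; it shrinks
        -- to size `j` when `P` is removed.
        obtain ⟨b, hb, hbκ⟩ := exists_block σ (j + 1) κ (by omega)
        let F' : (Fin m → ℕ) → MvPolynomial (Fin m) ℂ →ₗ[ℂ] W := fun w =>
          (F (update w P j)).comp (LinearMap.mulLeft ℂ (MvPolynomial.X P ^ κ))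
        have hF' : ∀ w g, F' w g = F (update w P j) (MvPolynomial.X P ^ κ * g) := fun _ _ => rfl
        have hset : ∀ (w : Fin m → ℕ) (i : ℕ),
            ({p : Fin m | p.val < r ∧ update w P j p = i} : Finset (Fin m)) =
              ({p : Fin m | p.val < r ∧ w p = i} : Finset (Fin m)) := by
          intro w i
          ext p
          simp only [Finset.mem_filter, Finset.mem_univ, true_and]
          refine and_congr_right fun hp => ?_
          rw [Function.update_of_ne (by rintro rfl; omega)]
        -- `F'` is local on the first `r` positions: the terms of the position `P` in the relations
        -- for `F` either raise its letter above `j` or its exponent above `κ`, and both are already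
        -- known to vanish.
        have hF'z : F' = 0 := by
          refine ih (by omega) (update σ b j) F' ⟨?_, ?_⟩ ?_ ?_
          · intro i i' hi w a g
            have h := hF.raise i i' hi (update w P j) a (MvPolynomial.X P ^ κ * g)
            rw [sum_filter_lt_succ P hP, hset] at h
            have h0 : (if update w P j P = i then F (update (update w P j) P i')
                (MvPolynomial.X P ^ a * (MvPolynomial.X P ^ κ * g)) else 0) = 0 := by
              split_ifs with hi'
              · rw [hjz, LinearMap.zero_apply]
                simp only [Function.update_self] at hi' ⊢
                omega
              · rfl
            rw [h0, zero_add] at h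
            rw [← h]
            refine Finset.sum_congr rfl fun p hp => ?_
            have hpP : p ≠ P := by
              rintro rfl
              simp only [Finset.mem_filter] at hp
              omega
            rw [hF', Function.update_comm hpP, mul_left_comm]
          · intro i a w g
            have h := hF.cartan i a (update w P j) (MvPolynomial.X P ^ κ * g)
            rw [sum_filter_lt_succ P hP, hset] at h
            have h0 : (if update w P j P = i then F (update w P j)
                (MvPolynomial.X P ^ (a + 1) * (MvPolynomial.X P ^ κ * g)) else 0) = 0 := by
              split_ifs with hi'
              · rw [← mul_assoc, ← pow_add, add_comm (a + 1)]
                exact hz _ (by simp) a g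
              · rfl
            rw [h0, zero_add] at h
            rw [← h]
            refine Finset.sum_congr rfl fun p _ => ?_
            rw [hF', mul_left_comm]
          · intro w i hi
            refine LinearMap.ext fun g => ?_
            rw [hF', hc (update w P j) i, LinearMap.zero_apply, LinearMap.zero_apply]
            rw [card_filter_lt_succ P hP, hset, Function.update_self]
            intro h
            refine hi ?_
            have hS : ({c | i < σ c} : Finset (Fin N)).card =
                (if j = i then 1 else 0) + ({c | i < update σ b j c} : Finset (Fin N)).card := by
              have hne : ∀ c ∈ ({b}ᶜ : Finset (Fin N)), update σ b j c = σ c := fun c hc =>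
                Function.update_of_ne (by simpa using hc) _ _
              rw [Finset.card_filter, Finset.card_filter, Fintype.sum_eq_add_sum_compl b,
                Fintype.sum_eq_add_sum_compl b (fun c => if i < update σ b j c then 1 else 0),
                Function.update_self, hb, ← add_assoc]
              congr 1
              · split_ifs <;> omega
              · exact Finset.sum_congr rfl fun c hc => by rw [hne c hc]
            omega
          · intro π hπ w k hwk
            rw [hF']
            -- The hypothesis on `k` leaves its value at `P` free. If it is `0`, sending `P` to `b`
            -- extends `π` to one of the maps in `hv`; otherwise the exponent of `X_P` exceeds `κ`
            -- and `hz` applies.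
            by_cases hk : k P = 0
            · have hmon : MvPolynomial.X P ^ κ * MvPolynomial.monomial k (1 : ℂ) =
                  MvPolynomial.monomial (k + Finsupp.single P κ) 1 := by
                rw [MvPolynomial.X_pow_eq_monomial, MvPolynomial.monomial_mul, mul_one, add_comm]
              have hpe : ∀ q : Fin m, q.val < r → update π P b q = π q := fun q hq =>
                Function.update_of_ne (by rintro rfl; omega) _ _
              have hsz : ∀ c, Finset.card {q : Fin m | q.val < r ∧ update π P b q = c} =
                  update σ b j c := by
                intro c
                rw [← hπ c]
                congr 1
                ext q
                simp only [Finset.mem_filter, Finset.mem_univ, true_and]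
                exact and_congr_right fun hq => by rw [hpe q hq]
              have hle : ∀ c, Finset.card {q : Fin m | q.val < r + 1 ∧ update π P b q = c} =
                  σ c := by
                intro c
                rw [card_filter_lt_succ P hP, hsz, Function.update_self]
                by_cases hcb : c = b
                · subst hcb; rw [if_pos rfl, Function.update_self, hb, add_comm]
                · rw [if_neg (Ne.symm hcb), Function.update_of_ne hcb, zero_add]
              have hwP : wordOf (update π P b) P = j := by
                have := hsz b
                rw [Function.update_self] at this
                rw [wordOf, ← this, Function.update_self]
                simp only [Fin.lt_def, hP]
              rw [hmon]
              refine hv (update π P b) hle _ _ fun p hp => ?_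
              by_cases hpP : p = P
              · subst hpP
                refine ⟨by rw [Function.update_self, hwP], ?_⟩
                rw [expOf, hwP, Function.update_self, ← hbκ, Finsupp.add_apply, hk, zero_add,
                  Finsupp.single_eq_same]
                congr 1
                ext c
                simp only [Finset.mem_filter, Finset.mem_univ, true_and]
                refine and_congr_right fun _ => ?_
                rw [← hle c]
                simp only [Fin.le_def, hP, Nat.lt_succ_iff]
              · have hpr : p.val < r := by
                  have : p.val ≠ r := fun h => hpP (Fin.ext (h.trans hP.symm))
                  omega
                have hq : ∀ q ≤ p, update π P b q = π q := fun q hq =>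
                  hpe q (lt_of_le_of_lt hq hpr)
                rw [Function.update_of_ne hpP, wordOf_congr hq, expOf_congr hq,
                  Finsupp.add_apply, Finsupp.single_eq_of_ne hpP, add_zero]
                exact hwk p hpr
            · obtain ⟨a, ha⟩ := Nat.exists_eq_succ_of_ne_zero hk
              have hmon : MvPolynomial.X P ^ κ * MvPolynomial.monomial k (1 : ℂ) =
                  MvPolynomial.X P ^ (κ + (a + 1)) * MvPolynomial.monomial (k.erase P) 1 := by
                rw [MvPolynomial.X_pow_eq_monomial, MvPolynomial.X_pow_eq_monomial,
                  MvPolynomial.monomial_mul, MvPolynomial.monomial_mul]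
                congr 2
                rw [Finsupp.single_add, add_assoc, ← Nat.succ_eq_add_one, ← ha,
                  Finsupp.single_add_erase]
              rw [hmon]
              exact hz _ (by simp) a _
        have := congrArg (fun f => f w g) hF'z
        simp only [hF'] at this
        rwa [Function.update_eq_self_iff.2 hw.symm] at this

end

/-! ### Balanced families and the spanning theorem -/

section

variable {m n N : ℕ} {W : Type*} [AddCommGroup W] [Module ℂ W]

/-- Families of linear maps, indexed by words, which behave like the multilinear functions
invariant under `SL_n(ℂ⟦t⟧)`: they vanish on the images of the raising operators, all Cartan
currents act on them in the same way, and they are supported on the words in which each of the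
letters `0, …, n - 1` occurs `N` times. -/
structure IsBalanced (n N : ℕ) (F : (Fin m → ℕ) → MvPolynomial (Fin m) ℂ →ₗ[ℂ] W) : Prop where
  raise : ∀ i j, i < j → ∀ (w : Fin m → ℕ) (a : ℕ) (g : MvPolynomial (Fin m) ℂ),
    ∑ p with w p = i, F (update w p j) (MvPolynomial.X p ^ a * g) = 0
  balance : ∀ j, j < n → ∀ (a : ℕ) (w : Fin m → ℕ) (g : MvPolynomial (Fin m) ℂ),
    ∑ p with w p = j, F w (MvPolynomial.X p ^ (a + 1) * g) =
      ∑ p with w p = 0, F w (MvPolynomial.X p ^ (a + 1) * g)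
  content : ∀ (w : Fin m → ℕ) (j : ℕ),
    Finset.card {p : Fin m | w p = j} ≠ (if j < n then N else 0) → F w = 0

/-- The power sum of the variables at the positions of the letter `0`. -/
def zeroSum (w : Fin m → ℕ) (a : ℕ) : MvPolynomial (Fin m) ℂ :=
  ∑ p with w p = 0, MvPolynomial.X p ^ (a + 1)

/-- The action of the algebra generated by the Cartan currents of the letter `0`. -/
def cartanAct (w : Fin m → ℕ) : MvPolynomial ℕ ℂ →ₐ[ℂ] MvPolynomial (Fin m) ℂ :=
  MvPolynomial.aeval (zeroSum w)

/-- The maps to a set of `N` blocks all of whose fibers have `n` elements. -/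
abbrev Blocks (m n N : ℕ) : Type :=
  {π : Fin m → Fin N // ∀ b, Finset.card {p : Fin m | π p = b} = n}

/-- The monomial of a map to a set of blocks. -/
def blockMonomial (π : Fin m → Fin N) : MvPolynomial (Fin m) ℂ :=
  MvPolynomial.monomial (Finsupp.equivFunOnFinite.symm (expOf π)) 1

lemma homogeneousComponent_X_pow_mul (d a : ℕ) (p : Fin m) (g : MvPolynomial (Fin m) ℂ) :
    MvPolynomial.homogeneousComponent d (MvPolynomial.X p ^ a * g) =
      MvPolynomial.X p ^ a *
        (if a ≤ d then MvPolynomial.homogeneousComponent (d - a) g else 0) := by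
  have h : ∀ e (k : Fin m →₀ ℕ) (c : ℂ), MvPolynomial.homogeneousComponent e
      (MvPolynomial.monomial k c) = if e = k.degree then MvPolynomial.monomial k c else 0 :=
    fun e k c => MvPolynomial.homogeneousComponent_of_mem
      (MvPolynomial.isHomogeneous_monomial c rfl)
  induction g using MvPolynomial.induction_on' with
  | monomial k c =>
    rw [MvPolynomial.X_pow_eq_monomial, MvPolynomial.monomial_mul, h, h, map_add,
      Finsupp.degree_single]
    by_cases ha : a ≤ d
    · rw [if_pos ha]
      by_cases hk : d - a = k.degree
      · rw [if_pos hk, if_pos (by omega), MvPolynomial.monomial_mul]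
      · rw [if_neg hk, if_neg (by omega), mul_zero]
    · rw [if_neg ha, if_neg (by omega), mul_zero]
  | add p q hp hq =>
    rw [mul_add, map_add, hp, hq, map_add]
    split_ifs <;> ring

lemma zeroSum_update (w : Fin m → ℕ) (a : ℕ) (p : Fin m) (j : ℕ) (hj : j ≠ 0) :
    zeroSum (update w p j) a =
      zeroSum w a - if w p = 0 then MvPolynomial.X p ^ (a + 1) else 0 := by
  rw [zeroSum, zeroSum, Finset.sum_filter, Finset.sum_filter, Fintype.sum_eq_add_sum_compl p,
    Fintype.sum_eq_add_sum_compl p (fun q => if w q = 0 then _ else _), Function.update_self,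
    if_neg hj, zero_add, add_sub_cancel_left]
  refine Finset.sum_congr rfl fun q hq => ?_
  rw [Function.update_of_ne (by simpa using hq)]

/-- The commutator of a Cartan current of degree `c + 1` with a raising operator of degree `a` is,
up to sign, zero or the raising operator of degree `c + 1 + a`, which kills `F` as well. -/
lemma IsBalanced.comp_zeroSum {F : (Fin m → ℕ) → MvPolynomial (Fin m) ℂ →ₗ[ℂ] W}
    (hF : IsBalanced n N F) (c : ℕ) :
    IsBalanced n N fun w => (F w).comp (LinearMap.mulLeft ℂ (zeroSum w c)) where
  raise i j hij w a g := by
    have h1 := hF.raise i j hij w a (zeroSum w c * g)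
    have h2 := hF.raise i j hij w (c + 1 + a) g
    have h3 : ∀ p ∈ ({p | w p = i} : Finset (Fin m)),
        ((F (update w p j)).comp (LinearMap.mulLeft ℂ (zeroSum (update w p j) c)))
          (MvPolynomial.X p ^ a * g) =
        F (update w p j) (MvPolynomial.X p ^ a * (zeroSum w c * g)) -
          if i = 0 then F (update w p j) (MvPolynomial.X p ^ (c + 1 + a) * g) else 0 := by
      intro p hp
      rw [Finset.mem_filter] at hp
      rw [LinearMap.comp_apply, LinearMap.mulLeft_apply, zeroSum_update w c p j (by omega), hp.2]
      split_ifs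
      · rw [← map_sub]
        congr 1
        ring
      · rw [sub_zero, sub_zero, mul_left_comm]
    rw [Finset.sum_congr rfl h3, Finset.sum_sub_distrib, h1]
    split_ifs
    · rw [h2, sub_zero]
    · simp
  balance j hj a w g := by
    have := hF.balance j hj a w (zeroSum w c * g)
    simpa only [LinearMap.comp_apply, LinearMap.mulLeft_apply, mul_left_comm] using this
  content w j h := by rw [hF.content w j h, LinearMap.zero_comp]

/-- A balanced family is determined by its values on the words and monomials of maps to blocks,
multiplied by Cartan currents. -/
theorem IsBalanced.eq_zero [Nonempty (Fin m → Fin N)]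
    {F : (Fin m → ℕ) → MvPolynomial (Fin m) ℂ →ₗ[ℂ] W} (hF : IsBalanced n N F)
    (hv : ∀ (π : Blocks m n N) (β : MvPolynomial ℕ ℂ),
      F (wordOf π.1) (cartanAct (wordOf π.1) β * blockMonomial π.1) = 0) : F = 0 := by
  -- A graded Nakayama argument. All `F` are treated at once, since the inductive hypothesis is
  -- applied to `F` composed with a Cartan current.
  suffices H : ∀ d, ∀ F : (Fin m → ℕ) → MvPolynomial (Fin m) ℂ →ₗ[ℂ] W, IsBalanced n N F →
      (∀ (π : Blocks m n N) (β : MvPolynomial ℕ ℂ),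
        F (wordOf π.1) (cartanAct (wordOf π.1) β * blockMonomial π.1) = 0) →
      ∀ w g, g.IsHomogeneous d → F w g = 0 by
    funext w
    exact linearMap_eq_zero fun k => H _ F hF hv w _ (MvPolynomial.isHomogeneous_monomial 1 rfl)
  clear hv hF F
  intro d
  induction d using Nat.strong_induction_on with
  | _ d ih =>
  intro F hF hv w g hg
  have hcart : ∀ a < d, ∀ w g, ∑ p with w p = 0,
      F w (MvPolynomial.X p ^ (a + 1) * MvPolynomial.homogeneousComponent (d - (a + 1)) g) = 0 := by
    intro a ha w g
    have h := ih (d - (a + 1)) (by omega) _ (hF.comp_zeroSum a) (fun π β => ?_) w _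
      (MvPolynomial.homogeneousComponent_isHomogeneous (d - (a + 1)) g)
    · rw [LinearMap.comp_apply, LinearMap.mulLeft_apply, zeroSum, Finset.sum_mul, map_sum] at h
      exact h
    · have h := hv π (MvPolynomial.X a * β)
      rw [map_mul (cartanAct _), cartanAct, MvPolynomial.aeval_X, mul_assoc] at h
      exact h
  -- Only the part of degree `d` is known to be killed by the positive Cartan currents, by `hcart`
  -- for the letter `0` and by `balance` for the others.
  let G : (Fin m → ℕ) → MvPolynomial (Fin m) ℂ →ₗ[ℂ] W := fun w =>
    (F w).comp (MvPolynomial.homogeneousComponent d)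
  have hG : G = 0 := by
    -- With all blocks of size `n`, the prescribed content is `N` occurrences of each letter below
    -- `n`.
    refine IsLocal.eq_zero m le_rfl (fun _ : Fin N => n) G ⟨?_, ?_⟩ ?_ ?_
    · intro i j hij w a g
      simp only [Fin.is_lt, true_and, G, LinearMap.comp_apply, homogeneousComponent_X_pow_mul]
      exact hF.raise i j hij w a _
    · intro j a w g
      simp only [Fin.is_lt, true_and, G, LinearMap.comp_apply, homogeneousComponent_X_pow_mul]
      by_cases hj : j < n
      · rw [hF.balance j hj]
        split_ifs with had
        · exact hcart a (by omega) w g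
        · simp
      · refine Finset.sum_eq_zero fun p hp => ?_
        rw [hF.content w j, LinearMap.zero_apply]
        rw [if_neg hj, Finset.card_ne_zero]
        exact ⟨p, hp⟩
    · intro w j h
      simp only [Fin.is_lt, true_and] at h
      simp only [G]
      rw [hF.content w j, LinearMap.zero_comp]
      intro h'
      refine h (h'.trans ?_)
      split_ifs with hj <;> simp [hj]
    · intro π hπ w k hwk
      have hw : w = wordOf π := funext fun p => (hwk p p.2).1
      have hk : k = Finsupp.equivFunOnFinite.symm (expOf π) := Finsupp.ext fun p => (hwk p p.2).2
      have h := hv ⟨π, fun b => by simpa using hπ b⟩ 1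
      rw [map_one, one_mul, blockMonomial, ← hw, ← hk] at h
      simp only [G, LinearMap.comp_apply]
      rw [MvPolynomial.homogeneousComponent_of_mem (MvPolynomial.isHomogeneous_monomial 1 rfl)]
      split_ifs
      · exact h
      · exact map_zero _
  have h := congrArg (fun f => f w g) hG
  simp only [G, LinearMap.comp_apply] at h
  rwa [MvPolynomial.homogeneousComponent_of_mem hg, if_pos rfl] at h

/-- The space on which the families indexed by words are linear maps. -/
abbrev WordSpace (m : ℕ) : Type := (Fin m → ℕ) →₀ MvPolynomial (Fin m) ℂ

/-- The elements of `WordSpace m` which are killed by all balanced families. -/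
def relations (m n N : ℕ) : Submodule ℂ (WordSpace m) :=
  Submodule.span ℂ
    ({x | ∃ (i j : ℕ) (w : Fin m → ℕ) (a : ℕ) (g : MvPolynomial (Fin m) ℂ), i < j ∧
        x = ∑ p with w p = i, Finsupp.single (update w p j) (MvPolynomial.X p ^ a * g)} ∪
      {x | ∃ (j a : ℕ) (w : Fin m → ℕ) (g : MvPolynomial (Fin m) ℂ), j < n ∧
        x = ∑ p with w p = j, Finsupp.single w (MvPolynomial.X p ^ (a + 1) * g) -
          ∑ p with w p = 0, Finsupp.single w (MvPolynomial.X p ^ (a + 1) * g)} ∪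
      {x | ∃ (w : Fin m → ℕ) (j : ℕ) (g : MvPolynomial (Fin m) ℂ),
        Finset.card {p : Fin m | w p = j} ≠ (if j < n then N else 0) ∧ x = Finsupp.single w g})

lemma IsBalanced.relations_le {F : (Fin m → ℕ) → MvPolynomial (Fin m) ℂ →ₗ[ℂ] W}
    (hF : IsBalanced n N F) : relations m n N ≤ LinearMap.ker (Finsupp.lsum ℂ F) := by
  refine Submodule.span_le.2 ?_
  rintro x ((⟨i, j, w, a, g, hij, rfl⟩ | ⟨j, a, w, g, hj, rfl⟩) | ⟨w, j, g, hj, rfl⟩)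
  all_goals
    simp only [SetLike.mem_coe, LinearMap.mem_ker, map_sub, map_sum, Finsupp.lsum_single]
  · exact hF.raise i j hij w a g
  · exact sub_eq_zero.2 (hF.balance j hj a w g)
  · rw [hF.content w j hj, LinearMap.zero_apply]

/-- For `U = relations m n N` this is the universal balanced family; larger `U` turn the vanishing
theorem into a spanning statement. -/
lemma isBalanced_mkQ {U : Submodule ℂ (WordSpace m)} (hU : relations m n N ≤ U) :
    IsBalanced n N fun w => U.mkQ.comp (Finsupp.lsingle w) where
  raise i j hij w a g := by
    simp only [LinearMap.comp_apply, Finsupp.lsingle_apply, ← map_sum]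
    refine (Submodule.Quotient.mk_eq_zero _).2 (hU (Submodule.subset_span ?_))
    exact Or.inl (Or.inl ⟨i, j, w, a, g, hij, rfl⟩)
  balance j hj a w g := by
    simp only [LinearMap.comp_apply, Finsupp.lsingle_apply, ← map_sum]
    refine (Submodule.Quotient.eq _).2 (hU (Submodule.subset_span ?_))
    exact Or.inl (Or.inr ⟨j, a, w, g, hj, rfl⟩)
  content w j hj := by
    refine LinearMap.ext fun g => (Submodule.Quotient.mk_eq_zero _).2 (hU (Submodule.subset_span ?_))
    exact Or.inr ⟨w, j, g, hj, rfl⟩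

/-- The elements which span `WordSpace m` modulo the relations. -/
def blockSpan (m n N : ℕ) : (Blocks m n N → MvPolynomial ℕ ℂ) →ₗ[ℂ] WordSpace m :=
  ∑ π : Blocks m n N, (Finsupp.lsingle (wordOf π.1)).comp
    ((LinearMap.mulRight ℂ (blockMonomial π.1)).comp
      ((cartanAct (wordOf π.1)).toLinearMap.comp (LinearMap.proj π)))

lemma blockSpan_apply (β : Blocks m n N → MvPolynomial ℕ ℂ) :
    blockSpan m n N β = ∑ π : Blocks m n N,
      Finsupp.single (wordOf π.1) (cartanAct (wordOf π.1) (β π) * blockMonomial π.1) := by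
  simp [blockSpan]

/-- The quotient by the left-hand side carries a balanced family that vanishes on all spanning
elements, so it is zero by `IsBalanced.eq_zero`. -/
theorem relations_sup_range_blockSpan [Nonempty (Fin m → Fin N)] :
    relations m n N ⊔ LinearMap.range (blockSpan m n N) = ⊤ := by
  set U := relations m n N ⊔ LinearMap.range (blockSpan m n N) with hU
  have h := (isBalanced_mkQ (n := n) (N := N) (U := U) le_sup_left).eq_zero ?_
  · rw [← U.ker_mkQ, LinearMap.ker_eq_top]
    refine Finsupp.lhom_ext' fun w => ?_
    rw [LinearMap.zero_comp]
    exact congrFun h w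
  · intro π β
    classical
    refine (Submodule.Quotient.mk_eq_zero _).2 (le_sup_right (a := relations m n N) ?_)
    refine ⟨Pi.single π β, ?_⟩
    rw [blockSpan_apply, Finset.sum_eq_single π]
    · rw [Pi.single_eq_same, Finsupp.lsingle_apply]
    · intro π' _ h
      rw [Pi.single_eq_of_ne h, map_zero, zero_mul, Finsupp.single_zero]
    · simp

end

/-! ### Products of determinants as balanced families -/

section

variable {m n N : ℕ} {W : Type*} [AddCommGroup W] [Module ℂ W]

/-- The matrix whose rows are the unit vectors of the letters of a word. -/
def letterMatrix (v : Fin n → ℕ) : Matrix (Fin n) (Fin n) ℂ :=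
  Matrix.of fun q i => if v q = i.val then 1 else 0

lemma letterMatrix_update (v : Fin n → ℕ) (q j : Fin n) :
    letterMatrix (update v q j) = (letterMatrix v).updateRow q (Pi.single j 1) := by
  ext q' i
  by_cases h : q' = q
  · subst h
    simp [letterMatrix, Pi.single_apply, Fin.ext_iff, eq_comm]
  · simp [letterMatrix, h, Function.update_of_ne]

lemma det_letterMatrix_eq_zero (v : Fin n → ℕ) (q : Fin n) (h : n ≤ v q) :
    (letterMatrix v).det = 0 := by
  refine Matrix.det_eq_zero_of_row_eq_zero q fun i => ?_
  rw [letterMatrix, Matrix.of_apply, if_neg (by omega)]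

/-- The entry `(j, i)` of `adjugate A * A = det A • 1`, since `adjugate A j q` is the determinant
with row `q` replaced by the `j`-th unit vector. -/
lemma sum_det_letterMatrix_update (v : Fin n → ℕ) (i j : Fin n) :
    ∑ q with v q = i.val, (letterMatrix (update v q j)).det =
      if i = j then (letterMatrix v).det else 0 := by
  have h := congrFun (congrFun (Matrix.adjugate_mul (letterMatrix v)) j) i
  rw [Matrix.mul_apply, Matrix.smul_apply, Matrix.one_apply, smul_eq_mul, mul_ite, mul_one,
    mul_zero] at h
  simp only [eq_comm (a := j)] at h
  rw [← h, Finset.sum_filter]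
  refine Finset.sum_congr rfl fun q _ => ?_
  rw [Matrix.adjugate_apply, ← letterMatrix_update,
    show letterMatrix v q i = if v q = i.val then 1 else 0 from rfl, mul_ite, mul_one, mul_zero]

lemma det_letterMatrix_ne_zero (v : Fin n → ℕ) (hv : Function.Injective v) (h : ∀ q, v q < n) :
    (letterMatrix v).det ≠ 0 := by
  let f : Fin n → Fin n := fun q => ⟨v q, h q⟩
  have hf : Function.Injective f := fun a b hab => hv (congrArg Fin.val hab)
  let e : Equiv.Perm (Fin n) := Equiv.ofBijective f (Finite.injective_iff_bijective.1 hf)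
  have h1 : letterMatrix v = (1 : Matrix (Fin n) (Fin n) ℂ).submatrix e id := by
    ext q i
    simp [letterMatrix, Matrix.one_apply, e, f, Fin.ext_iff]
  rw [h1, Matrix.det_permute, Matrix.det_one, mul_one]
  exact_mod_cast (Equiv.Perm.sign e).ne_zero

/-- An enumeration of the elements of the blocks. -/
def blockEquiv (π : Blocks m n N) : Fin N × Fin n ≃ Fin m :=
  (Equiv.sigmaEquivProd (Fin N) (Fin n)).symm.trans
    ((Equiv.sigmaCongrRight fun b =>
      (Fintype.equivFinOfCardEq (α := {p // π.1 p = b})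
        ((Fintype.card_subtype _).trans (π.2 b))).symm).trans (Equiv.sigmaFiberEquiv π.1))

@[simp] lemma blockEquiv_apply (π : Blocks m n N) (x : Fin N × Fin n) :
    π.1 (blockEquiv π x) = x.1 :=
  ((Fintype.equivFinOfCardEq (α := {p // π.1 p = x.1})
    ((Fintype.card_subtype _).trans (π.2 x.1))).symm x.2).2

/-- The letters of a word in a block. -/
def blockWord (π : Blocks m n N) (w : Fin m → ℕ) (b : Fin N) (q : Fin n) : ℕ :=
  w (blockEquiv π (b, q))

/-- The product over all blocks of the sign of the word in the block. -/
def blockSign (π : Blocks m n N) (w : Fin m → ℕ) : ℂ :=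
  ∏ b, (letterMatrix (blockWord π w b)).det

lemma blockWord_update_same (π : Blocks m n N) (w : Fin m → ℕ) (b : Fin N) (q : Fin n) (j : ℕ) :
    blockWord π (update w (blockEquiv π (b, q)) j) b = update (blockWord π w b) q j := by
  funext q'
  by_cases h : q' = q
  · subst h; simp [blockWord]
  · rw [Function.update_of_ne h, blockWord, Function.update_of_ne, blockWord]
    simpa using h

lemma blockWord_update_of_ne (π : Blocks m n N) (w : Fin m → ℕ) (b b' : Fin N) (q : Fin n)
    (j : ℕ) (h : b' ≠ b) :
    blockWord π (update w (blockEquiv π (b, q)) j) b' = blockWord π w b' := by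
  funext q'
  rw [blockWord, Function.update_of_ne, blockWord]
  simp [h]

lemma blockSign_eq_zero (π : Blocks m n N) (w : Fin m → ℕ) (p : Fin m) (h : n ≤ w p) :
    blockSign π w = 0 := by
  obtain ⟨⟨b, q⟩, rfl⟩ := (blockEquiv π).surjective p
  exact Finset.prod_eq_zero (Finset.mem_univ b) (det_letterMatrix_eq_zero _ q h)

/-- The adjugate identity in each block separately; the weight `φ` is constant on a block and
factors out. This is the invariance under `gl_n`-currents up to trace. -/
lemma sum_blockSign_update (π : Blocks m n N) (w : Fin m → ℕ) (i j : Fin n) (φ : Fin N → W) :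
    ∑ p with w p = i.val, blockSign π (update w p j) • φ (π.1 p) =
      if i = j then blockSign π w • ∑ b, φ b else 0 := by
  have hs : ∀ b q, blockSign π (update w (blockEquiv π (b, q)) j) =
      (letterMatrix (update (blockWord π w b) q j)).det *
        ∏ b' ∈ Finset.univ.erase b, (letterMatrix (blockWord π w b')).det := by
    intro b q
    rw [blockSign, ← Finset.mul_prod_erase _ _ (Finset.mem_univ b), blockWord_update_same]
    congr 1
    refine Finset.prod_congr rfl fun b' hb' => ?_
    rw [blockWord_update_of_ne _ _ _ _ _ _ (Finset.ne_of_mem_erase hb')]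
  rw [Finset.sum_filter, ← (blockEquiv π).sum_comp, Fintype.sum_prod_type]
  have h1 : ∀ b, ∑ q, (if w (blockEquiv π (b, q)) = i.val then
      blockSign π (update w (blockEquiv π (b, q)) j) • φ (π.1 (blockEquiv π (b, q))) else 0) =
      if i = j then blockSign π w • φ b else 0 := by
    intro b
    have h2 := sum_det_letterMatrix_update (blockWord π w b) i j
    calc _ = ∑ q with blockWord π w b q = i.val,
        ((letterMatrix (update (blockWord π w b) q j)).det *
          ∏ b' ∈ Finset.univ.erase b, (letterMatrix (blockWord π w b')).det) • φ b := by
          rw [Finset.sum_filter]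
          refine Finset.sum_congr rfl fun q _ => ?_
          rw [hs, blockEquiv_apply, blockWord]
      _ = _ := by
        rw [← Finset.sum_smul, ← Finset.sum_mul, h2]
        split_ifs
        · rw [Finset.mul_prod_erase _ (fun b => (letterMatrix (blockWord π w b)).det)
            (Finset.mem_univ b), blockSign]
        · rw [zero_mul, zero_smul]
  rw [Finset.sum_congr rfl fun b _ => h1 b]
  split_ifs
  · rw [Finset.smul_sum]
  · simp

lemma sum_blockSign (π : Blocks m n N) (w : Fin m → ℕ) (i : ℕ) (hi : i < n) (φ : Fin N → W) :
    ∑ p with w p = i, blockSign π w • φ (π.1 p) = blockSign π w • ∑ b, φ b := by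
  have h := sum_blockSign_update π w ⟨i, hi⟩ ⟨i, hi⟩ φ
  rw [if_pos rfl] at h
  rw [← h]
  refine Finset.sum_congr rfl fun p hp => ?_
  rw [Finset.mem_filter] at hp
  rw [← hp.2, Function.update_eq_self]

/-- Evaluation at the points whose coordinates agree in the blocks, together with the sign of the
word. -/
def blockEval (π : Blocks m n N) (w : Fin m → ℕ) :
    MvPolynomial (Fin m) ℂ →ₗ[ℂ] MvPolynomial (Fin N) ℂ :=
  blockSign π w • (MvPolynomial.rename π.1).toLinearMap

lemma blockEval_apply (π : Blocks m n N) (w : Fin m → ℕ) (g : MvPolynomial (Fin m) ℂ) :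
    blockEval π w g = blockSign π w • MvPolynomial.rename π.1 g := rfl

lemma isBalanced_blockEval (π : Blocks m n N) : IsBalanced n N (blockEval π) where
  raise i j hij w a g := by
    by_cases hj : j < n
    · have h := sum_blockSign_update π w ⟨i, hij.trans hj⟩ ⟨j, hj⟩ fun b =>
        (MvPolynomial.X b ^ a * MvPolynomial.rename π.1 g : MvPolynomial (Fin N) ℂ)
      rw [if_neg (by simp [hij.ne])] at h
      simpa only [blockEval_apply, map_mul, map_pow, MvPolynomial.rename_X] using h
    · refine Finset.sum_eq_zero fun p _ => ?_
      rw [blockEval_apply, blockSign_eq_zero π _ p (by simpa using hj), zero_smul]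
  balance j hj a w g := by
    have h : ∀ i < n, _ := fun i hi => sum_blockSign π w i hi fun b =>
      (MvPolynomial.X b ^ (a + 1) * MvPolynomial.rename π.1 g : MvPolynomial (Fin N) ℂ)
    simp only [blockEval_apply, map_mul, map_pow, MvPolynomial.rename_X]
    rw [h j hj, h 0 (by omega)]
  content w j hj := by
    suffices h : blockSign π w = 0 by
      refine LinearMap.ext fun g => ?_
      rw [blockEval_apply, h, zero_smul, LinearMap.zero_apply]
    split_ifs at hj with hjn
    -- With weight `1` the identity reads: number of occurrences of `j` times the sign equals `N`
    -- times the sign.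
    · have h := sum_blockSign π w j hjn fun _ => (1 : ℂ)
      simp only [smul_eq_mul, mul_one, Finset.sum_const, Finset.card_univ, Fintype.card_fin,
        nsmul_eq_mul] at h
      by_contra h0
      rw [mul_comm] at h
      exact hj (by exact_mod_cast mul_left_cancel₀ h0 h)
    · obtain ⟨p, hp⟩ := Finset.card_ne_zero.1 hj
      rw [Finset.mem_filter] at hp
      exact blockSign_eq_zero π w p (by omega)

/-- The power sums in the coordinates of the blocks. -/
def powerSums (N : ℕ) : MvPolynomial ℕ ℂ →ₐ[ℂ] MvPolynomial (Fin N) ℂ :=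
  MvPolynomial.aeval fun a => ∑ b, MvPolynomial.X b ^ (a + 1)

/-- When the sign is nonzero, the letter `0` occurs once in each block, so a power sum over its
positions becomes the power sum in the block coordinates. -/
lemma blockEval_cartanAct_mul (hn : 0 < n) (π : Blocks m n N) (w : Fin m → ℕ)
    (β : MvPolynomial ℕ ℂ) (g : MvPolynomial (Fin m) ℂ) :
    blockEval π w (cartanAct w β * g) = powerSums N β * blockEval π w g := by
  rw [blockEval_apply, blockEval_apply, map_mul, mul_smul_comm]
  by_cases h0 : blockSign π w = 0
  · rw [h0, zero_smul, zero_smul]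
  suffices h : (MvPolynomial.rename π.1).comp (cartanAct w) = powerSums N by
    rw [← h, AlgHom.comp_apply]
  refine MvPolynomial.algHom_ext fun a => ?_
  have h := sum_blockSign π w 0 hn fun b => (MvPolynomial.X b ^ (a + 1) : MvPolynomial (Fin N) ℂ)
  rw [← Finset.smul_sum] at h
  rw [AlgHom.comp_apply, cartanAct, powerSums, MvPolynomial.aeval_X, MvPolynomial.aeval_X, zeroSum,
    map_sum]
  simp only [map_pow, MvPolynomial.rename_X]
  exact smul_right_injective _ h0 h

lemma wordOf_lt_wordOf (π : Fin m → Fin N) (p q : Fin m) (h : p < q) (hpq : π p = π q) :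
    wordOf π p < wordOf π q := by
  refine Finset.card_lt_card (Finset.ssubset_iff_subset_ne.2 ⟨?_, ?_⟩)
  · intro r hr
    simp only [Finset.mem_filter, Finset.mem_univ, true_and] at hr ⊢
    exact ⟨hr.1.trans h, hr.2.trans hpq⟩
  · intro heq
    have : p ∈ ({r : Fin m | r < q ∧ π r = π q} : Finset (Fin m)) := by simp [h, hpq]
    rw [← heq] at this
    simp at this

lemma wordOf_lt (π : Blocks m n N) (p : Fin m) : wordOf π.1 p < n := by
  refine lt_of_lt_of_eq ?_ (π.2 (π.1 p))
  refine Finset.card_lt_card (Finset.ssubset_iff_subset_ne.2 ⟨?_, ?_⟩)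
  · intro r hr
    simp only [Finset.mem_filter, Finset.mem_univ, true_and] at hr ⊢
    exact hr.2
  · intro heq
    have : p ∈ ({r : Fin m | π.1 r = π.1 p} : Finset (Fin m)) := by simp
    rw [← heq] at this
    simp at this

lemma blockSign_wordOf_ne_zero (π : Blocks m n N) : blockSign π (wordOf π.1) ≠ 0 := by
  refine Finset.prod_ne_zero_iff.2 fun b _ =>
    det_letterMatrix_ne_zero _ (fun q q' h => ?_) fun q => wordOf_lt π _
  have hb : ∀ q q', π.1 (blockEquiv π (b, q)) = π.1 (blockEquiv π (b, q')) := by simp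
  rcases lt_trichotomy (blockEquiv π (b, q)) (blockEquiv π (b, q')) with h' | h' | h'
  · exact absurd h (wordOf_lt_wordOf π.1 _ _ h' (hb _ _)).ne
  · simpa using h'
  · exact absurd h (wordOf_lt_wordOf π.1 _ _ h' (hb _ _)).ne'

/-- The Cartan currents act faithfully on the word of a map to blocks. -/
lemma cartanAct_wordOf_eq_zero (hn : 0 < n) (π : Blocks m n N) (β : MvPolynomial ℕ ℂ)
    (h : powerSums N β = 0) : cartanAct (wordOf π.1) β = 0 := by
  have hne : ∀ b, (({p : Fin m | π.1 p = b} : Finset (Fin m))).Nonempty := fun b => by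
    rw [← Finset.card_pos, π.2 b]; exact hn
  -- The letter `0` of `wordOf` sits exactly at the first element of each block, so `f` identifies
  -- the two families of power sums.
  let f : Fin N → Fin m := fun b => Finset.min' _ (hne b)
  have hf : ∀ b, π.1 (f b) = b := fun b => by
    have := Finset.min'_mem _ (hne b)
    exact (Finset.mem_filter.1 this).2
  have hmin : ∀ p, f (π.1 p) ≤ p := fun p => Finset.min'_le _ _ (by simp)
  suffices H : (MvPolynomial.rename f).comp (powerSums N) = cartanAct (wordOf π.1) by
    rw [← H, AlgHom.comp_apply, h, map_zero]
  refine MvPolynomial.algHom_ext fun a => ?_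
  rw [AlgHom.comp_apply, cartanAct, powerSums, MvPolynomial.aeval_X, MvPolynomial.aeval_X, zeroSum,
    map_sum]
  simp only [map_pow, MvPolynomial.rename_X]
  have h0 : ∀ p, wordOf π.1 p = 0 ↔ f (π.1 p) = p := by
    intro p
    constructor
    · intro hp
      by_contra hne'
      have := wordOf_lt_wordOf π.1 _ p (lt_of_le_of_ne (hmin p) hne') (hf _)
      omega
    · intro hp
      rw [wordOf, Finset.card_eq_zero, Finset.filter_eq_empty_iff]
      rintro q - ⟨hq, hq'⟩
      have := hmin q
      rw [hq', hp] at this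
      exact absurd hq (not_lt.2 this)
  refine Finset.sum_bij (fun b _ => f b) (fun b _ => ?_) (fun b _ c _ hbc => ?_) (fun p hp => ?_)
    fun _ _ => rfl
  · simp [h0, hf]
  · rw [← hf b, hbc, hf]
  · rw [Finset.mem_filter, h0] at hp
    exact ⟨π.1 p, Finset.mem_univ _, hp.2⟩

/-- All evaluations at once. -/
def totalEval (m n N : ℕ) : WordSpace m →ₗ[ℂ] Blocks m n N → MvPolynomial (Fin N) ℂ :=
  LinearMap.pi fun π => Finsupp.lsum ℂ (blockEval π)

lemma totalEval_single (w : Fin m → ℕ) (g : MvPolynomial (Fin m) ℂ) (π : Blocks m n N) :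
    totalEval m n N (Finsupp.single w g) π = blockEval π w g := by
  simp [totalEval]

lemma totalEval_relations {x : WordSpace m} (hx : x ∈ relations m n N) : totalEval m n N x = 0 :=
  funext fun π => (isBalanced_blockEval π).relations_le hx

/-- The values of the evaluations at the spanning elements. -/
def blockMatrix (m n N : ℕ) :
    Matrix (Blocks m n N) (Blocks m n N) (MvPolynomial (Fin N) ℂ) :=
  Matrix.of fun τ π => blockEval π (wordOf τ.1) (blockMonomial τ.1)

lemma totalEval_blockSpan (hn : 0 < n) (β : Blocks m n N → MvPolynomial ℕ ℂ) :
    totalEval m n N (blockSpan m n N β) =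
      Matrix.vecMul (fun τ => powerSums N (β τ)) (blockMatrix m n N) := by
  funext π
  rw [blockSpan_apply, map_sum, Finset.sum_apply, Matrix.vecMul, dotProduct]
  refine Finset.sum_congr rfl fun τ _ => ?_
  rw [totalEval_single, blockEval_cartanAct_mul hn]
  rfl

/-- At a point with distinct coordinates the evaluations for different `π` are independent. The
relations contribute nothing, so the rows of the specialized square matrix span, and it is
invertible. -/
lemma det_blockMatrix_ne_zero [Nonempty (Fin m → Fin N)] (hn : 0 < n) :
    (blockMatrix m n N).det ≠ 0 := by
  classical
  let z : Fin N → ℂ := fun b => (b.val : ℂ)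
  have hz : Function.Injective z := fun a b h => Fin.ext (by simpa [z] using h)
  let ev : MvPolynomial (Fin N) ℂ →ₐ[ℂ] ℂ := MvPolynomial.aeval z
  let evT : WordSpace m →ₗ[ℂ] Blocks m n N → ℂ :=
    LinearMap.pi fun π => ev.toLinearMap.comp ((LinearMap.proj π).comp (totalEval m n N))
  have hevT : ∀ x π, evT x π = ev (totalEval m n N x π) := fun _ _ => rfl
  have hsurj : LinearMap.range evT = ⊤ := by
    rw [eq_top_iff, ← (Pi.basisFun ℂ (Blocks m n N)).span_eq, Submodule.span_le]
    rintro _ ⟨π₀, rfl⟩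
    -- Lagrange interpolation: among the points `p ↦ z (π p)`, nonzero only at the one of `π₀`.
    let g : MvPolynomial (Fin m) ℂ := ∏ p, ∏ b ∈ Finset.univ.erase (π₀.1 p),
      (MvPolynomial.X p - MvPolynomial.C (z b))
    have hg : ∀ π : Blocks m n N, ev (MvPolynomial.rename π.1 g) =
        ∏ p, ∏ b ∈ Finset.univ.erase (π₀.1 p), (z (π.1 p) - z b) := by
      intro π
      simp [g, ev, map_prod]
    have hg0 : ev (MvPolynomial.rename π₀.1 g) ≠ 0 := by
      rw [hg]
      refine Finset.prod_ne_zero_iff.2 fun p _ => Finset.prod_ne_zero_iff.2 fun b hb => ?_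
      exact sub_ne_zero.2 fun h => Finset.ne_of_mem_erase hb (hz h).symm
    have hg1 : ∀ π, π ≠ π₀ → ev (MvPolynomial.rename π.1 g) = 0 := by
      intro π hπ
      obtain ⟨p, hp⟩ : ∃ p, π.1 p ≠ π₀.1 p := by
        by_contra h
        push Not at h
        exact hπ (Subtype.ext (funext h))
      rw [hg]
      exact Finset.prod_eq_zero (Finset.mem_univ p)
        (Finset.prod_eq_zero (i := π.1 p) (by simp [hp]) (sub_self _))
    refine ⟨(blockSign π₀ (wordOf π₀.1) * ev (MvPolynomial.rename π₀.1 g))⁻¹ •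
      Finsupp.single (wordOf π₀.1) g, ?_⟩
    funext π
    rw [map_smul, Pi.smul_apply, hevT, totalEval_single, blockEval_apply, map_smul, Pi.basisFun_apply]
    by_cases hπ : π = π₀
    · subst hπ
      rw [Pi.single_eq_same, smul_eq_mul, smul_eq_mul]
      exact inv_mul_cancel₀ (mul_ne_zero (blockSign_wordOf_ne_zero π) hg0)
    · rw [Pi.single_eq_of_ne hπ, hg1 π hπ, smul_zero, smul_zero]
  have hM : IsUnit ((blockMatrix m n N).map ev) := by
    rw [← Matrix.vecMul_surjective_iff_isUnit]
    intro y
    obtain ⟨x, rfl⟩ := LinearMap.range_eq_top.1 hsurj y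
    have hx : x ∈ relations m n N ⊔ LinearMap.range (blockSpan m n N) := by
      rw [relations_sup_range_blockSpan]; trivial
    obtain ⟨u, hu, _, ⟨β, rfl⟩, rfl⟩ := Submodule.mem_sup.1 hx
    refine ⟨fun τ => ev (powerSums N (β τ)), ?_⟩
    funext π
    rw [hevT, map_add, totalEval_relations hu, zero_add, totalEval_blockSpan hn]
    simp only [Matrix.vecMul, dotProduct, map_sum, map_mul, Matrix.map_apply]
  intro h0
  have h1 : ev (blockMatrix m n N).det = ((blockMatrix m n N).map ev).det :=
    AlgHom.map_det ev _
  rw [h0, map_zero] at h1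
  exact ((Matrix.isUnit_iff_isUnit_det _).1 hM).ne_zero h1.symm

/-- Modulo relations an element is `blockSpan β`. If its evaluations vanish, the nonzero determinant
over a domain forces `powerSums N (β τ) = 0` for all `τ`, and then the Cartan currents `β τ` act by
zero on the spanning elements. -/
theorem ker_totalEval_le [Nonempty (Fin m → Fin N)] (hn : 0 < n) :
    LinearMap.ker (totalEval m n N) ≤ relations m n N := by
  classical
  intro x hx
  have hx' : x ∈ relations m n N ⊔ LinearMap.range (blockSpan m n N) := by
    rw [relations_sup_range_blockSpan]; trivial
  obtain ⟨u, hu, _, ⟨β, rfl⟩, rfl⟩ := Submodule.mem_sup.1 hx'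
  rw [LinearMap.mem_ker, map_add, totalEval_relations hu, zero_add, totalEval_blockSpan hn] at hx
  have h := Matrix.eq_zero_of_vecMul_eq_zero (det_blockMatrix_ne_zero hn) hx
  rw [blockSpan_apply, Finset.sum_eq_zero, add_zero]
  · exact hu
  · intro τ _
    rw [cartanAct_wordOf_eq_zero hn τ _ (congrFun h τ), zero_mul, Finsupp.single_zero]

/-- Balanced families are combinations of products of determinants. -/
theorem IsBalanced.exists_eq_sum [Nonempty (Fin m → Fin N)] (hn : 0 < n)
    {F : (Fin m → ℕ) → MvPolynomial (Fin m) ℂ →ₗ[ℂ] W} (hF : IsBalanced n N F) :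
    ∃ G : Blocks m n N → MvPolynomial (Fin N) ℂ →ₗ[ℂ] W,
      ∀ w g, F w g = ∑ π, G π (blockEval π w g) := by
  classical
  let Φ := totalEval m n N
  have hker : LinearMap.ker Φ ≤ LinearMap.ker (Finsupp.lsum ℂ F) :=
    (ker_totalEval_le hn).trans hF.relations_le
  -- `F` factors through the image of `Φ`; over a field a linear retraction extends it to the whole
  -- product of polynomial rings.
  obtain ⟨s, hs⟩ := ((LinearMap.ker Φ).liftQ Φ le_rfl).exists_leftInverse_of_injective
    (Submodule.ker_liftQ_eq_bot _ _ _ le_rfl)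
  let H := ((LinearMap.ker Φ).liftQ (Finsupp.lsum ℂ F) hker).comp s
  have hH : ∀ x, H (Φ x) = Finsupp.lsum ℂ F x := by
    intro x
    have := LinearMap.congr_fun hs ((LinearMap.ker Φ).mkQ x)
    simp only [LinearMap.comp_apply, Submodule.mkQ_apply, Submodule.liftQ_apply,
      LinearMap.id_apply] at this
    simp only [H, LinearMap.comp_apply, this, Submodule.liftQ_apply]
  refine ⟨fun π => H.comp (LinearMap.single ℂ (fun _ => MvPolynomial (Fin N) ℂ) π), fun w g => ?_⟩
  have h1 := hH (Finsupp.single w g)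
  rw [Finsupp.lsum_single] at h1
  rw [← h1]
  have h2 : Φ (Finsupp.single w g) = ∑ π, LinearMap.single ℂ (fun _ => MvPolynomial (Fin N) ℂ) π
      (blockEval π w g) := by
    funext π
    rw [totalEval_single, Finset.sum_apply, Finset.sum_eq_single π]
    · simp
    · intro π' _ h
      simp [h.symm]
    · simp
  rw [h2, map_sum]
  rfl

end

/-! ### Coordinates on the arc space and the current algebra -/

section

variable {n l : ℕ}

/-- The coordinates of the arc space of `ℓ ℂ^n`: the triple `(i, c, k)` is the coefficient of `t^k`
in the `i`-th coordinate on the `c`-th copy of `ℂ^n`. -/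
abbrev ArcVar (n l : ℕ) : Type := Fin n × Fin l × ℕ

abbrev ArcPoly (n l : ℕ) : Type := MvPolynomial (ArcVar n l) ℂ

/-- The generic matrix of power series. -/
def genericArc (n l : ℕ) : Matrix (Fin n) (Fin l) (ArcPoly n l)⟦X⟧ :=
  Matrix.of fun i c => PowerSeries.mk fun k => MvPolynomial.X (i, c, k)

def toArcPoly (n l : ℕ) : Arc.CoordRing (SLInv.OV n l) →ₐ[ℂ] ArcPoly n l :=
  Arc.eval (SLInv.point (genericArc n l))

def ofArcPoly (n l : ℕ) : ArcPoly n l →ₐ[ℂ] Arc.CoordRing (SLInv.OV n l) :=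
  MvPolynomial.aeval fun v => Arc.coeff (MvPolynomial.X (v.1, v.2.1)) v.2.2

lemma map_genericArc {A : Type*} [CommRing A] [Algebra ℂ A] (M : Matrix (Fin n) (Fin l) A⟦X⟧) :
    (PowerSeries.mapAlgHom (MvPolynomial.aeval fun v : ArcVar n l =>
      PowerSeries.coeff v.2.2 (M v.1 v.2.1))).comp (SLInv.point (genericArc n l)) =
      SLInv.point M := by
  refine MvPolynomial.algHom_ext fun p => ?_
  ext k
  simp [SLInv.point, genericArc, PowerSeries.mapAlgHom_apply]

/-- Every arc is a specialization of the generic one, so evaluation at `M` is substitution of its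
coefficients. -/
lemma eval_point_eq {A : Type*} [CommRing A] [Algebra ℂ A] (M : Matrix (Fin n) (Fin l) A⟦X⟧)
    (f : Arc.CoordRing (SLInv.OV n l)) :
    Arc.eval (SLInv.point M) f = MvPolynomial.aeval (fun v : ArcVar n l =>
      PowerSeries.coeff v.2.2 (M v.1 v.2.1)) (toArcPoly n l f) := by
  rw [← AlgHom.comp_apply]
  refine DFunLike.congr_fun (Arc.algHom_ext fun r k => ?_) f
  rw [Arc.eval_coeff, AlgHom.comp_apply, toArcPoly, Arc.eval_coeff, ← map_genericArc M,
    AlgHom.comp_apply, PowerSeries.mapAlgHom_apply, PowerSeries.coeff_map]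
  rfl

/-- Evaluation at the universal arc is the identity; by `eval_point_eq` it is also the substitution
on the left. -/
lemma ofArcPoly_toArcPoly (f : Arc.CoordRing (SLInv.OV n l)) :
    ofArcPoly n l (toArcPoly n l f) = f := by
  have h := eval_point_eq (A := Arc.CoordRing (SLInv.OV n l))
    (Matrix.of fun i c => Arc.univ (SLInv.OV n l) (MvPolynomial.X (i, c))) f
  have h1 : (SLInv.point (Matrix.of fun i c =>
      Arc.univ (SLInv.OV n l) (MvPolynomial.X (i, c)))) = Arc.univ (SLInv.OV n l) := by
    refine MvPolynomial.algHom_ext fun p => ?_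
    simp [SLInv.point]
  rw [h1] at h
  have h2 : Arc.eval (Arc.univ (SLInv.OV n l)) = AlgHom.id ℂ _ :=
    Arc.algHom_ext fun r k => by simp [Arc.univ]
  rw [h2] at h
  refine Eq.trans ?_ h.symm
  simp [ofArcPoly, Arc.univ]

/-- The derivation of the coordinate ring of the arc space defined by `H t^a`. -/
def currentDer (l : ℕ) (H : Matrix (Fin n) (Fin n) ℂ) (a : ℕ) :
    Derivation ℂ (ArcPoly n l) (ArcPoly n l) :=
  MvPolynomial.mkDerivation ℂ fun v : ArcVar n l =>
    if a ≤ v.2.2 then ∑ j, H v.1 j • MvPolynomial.X (j, v.2.1, v.2.2 - a) else 0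

/-- First-order Taylor expansion over dual numbers. -/
lemma aeval_inl_add_inr {σ : Type} (d : σ → MvPolynomial σ ℂ) (f : MvPolynomial σ ℂ) :
    MvPolynomial.aeval (fun v => (TrivSqZeroExt.inl (MvPolynomial.X v) + TrivSqZeroExt.inr (d v) :
      TrivSqZeroExt (MvPolynomial σ ℂ) (MvPolynomial σ ℂ))) f =
      TrivSqZeroExt.inl f + TrivSqZeroExt.inr (MvPolynomial.mkDerivation ℂ d f) := by
  induction f using MvPolynomial.induction_on with
  | C c =>
    rw [MvPolynomial.aeval_C, MvPolynomial.derivation_C, TrivSqZeroExt.inr_zero, add_zero]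
    rfl
  | add p q hp hq => rw [map_add, hp, hq, map_add, TrivSqZeroExt.inl_add, TrivSqZeroExt.inr_add]; abel
  | mul_X p i hp =>
    rw [map_mul, hp, MvPolynomial.aeval_X, Derivation.leibniz, MvPolynomial.mkDerivation_X]
    ext <;> simp [mul_comm, add_comm]

/-- Invariance under `1 + ε t^a H` at the generic arc over the dual numbers of `ArcPoly n l`: the
determinant is `1 + ε t^a tr H = 1`, and the `ε`-part of the invariance is the claim. -/
lemma currentDer_eq_zero (f : Arc.CoordRing (SLInv.OV n l)) (hf : f ∈ SLInv.arcInvariants n l)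
    (H : Matrix (Fin n) (Fin n) ℂ) (hH : H.trace = 0) (a : ℕ) :
    currentDer l H a (toArcPoly n l f) = 0 := by
  let A := TrivSqZeroExt (ArcPoly n l) (ArcPoly n l)
  let s : A⟦X⟧ := PowerSeries.C (TrivSqZeroExt.inr 1) * PowerSeries.X ^ a
  have hs : s ^ 2 = 0 := by
    rw [mul_pow, ← map_pow, pow_two (TrivSqZeroExt.inr 1), TrivSqZeroExt.inr_mul_inr, map_zero,
      zero_mul]
  let H' : Matrix (Fin n) (Fin n) A⟦X⟧ := H.map (algebraMap ℂ A⟦X⟧)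
  have hdet : (1 + s • H').det = 1 := by
    rw [Matrix.det_one_add_smul, hs, mul_zero, add_zero]
    have : H'.trace = algebraMap ℂ A⟦X⟧ H.trace := by simp [Matrix.trace, H', map_sum]
    rw [this, hH, map_zero, zero_mul, add_zero]
  let M : Matrix (Fin n) (Fin l) A⟦X⟧ :=
    Matrix.of fun i c => PowerSeries.mk fun k => TrivSqZeroExt.inl (MvPolynomial.X (i, c, k))
  have h := hf A ⟨1 + s • H', hdet⟩ M
  rw [eval_point_eq, eval_point_eq] at h
  have h1 : (fun v : ArcVar n l => PowerSeries.coeff v.2.2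
      (((1 + s • H') * M : Matrix (Fin n) (Fin l) A⟦X⟧) v.1 v.2.1)) =
      fun v => (TrivSqZeroExt.inl (MvPolynomial.X v) + TrivSqZeroExt.inr
        (if a ≤ v.2.2 then ∑ j, H v.1 j • MvPolynomial.X (j, v.2.1, v.2.2 - a) else 0) : A) := by
    funext ⟨i, c, k⟩
    rw [Matrix.add_mul, Matrix.one_mul, Matrix.add_apply, map_add, Matrix.smul_mul,
      Matrix.smul_apply, Matrix.mul_apply, smul_eq_mul]
    congr 1
    · simp [M]
    · simp only [s]
      rw [mul_assoc, PowerSeries.coeff_C_mul, PowerSeries.coeff_X_pow_mul']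
      split_ifs with hak
      · rw [map_sum, TrivSqZeroExt.inr_sum, Finset.mul_sum]
        refine Finset.sum_congr rfl fun j _ => ?_
        simp only [H', M, Matrix.map_apply, Matrix.of_apply]
        rw [← Algebra.smul_def, PowerSeries.coeff_smul, PowerSeries.coeff_mk, mul_smul_comm,
          TrivSqZeroExt.inr_mul_inl]
        simp
      · simp
  have h2 : (fun v : ArcVar n l => PowerSeries.coeff v.2.2 (M v.1 v.2.1)) =
      fun v => (TrivSqZeroExt.inl (MvPolynomial.X v) + TrivSqZeroExt.inr 0 : A) := by
    funext ⟨i, c, k⟩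
    simp [M]
  rw [show ((⟨1 + s • H', hdet⟩ : Matrix.SpecialLinearGroup (Fin n) A⟦X⟧).1 * M) =
    (1 + s • H') * M from rfl, h1, h2, aeval_inl_add_inr, aeval_inl_add_inr] at h
  have h3 := congrArg TrivSqZeroExt.snd h
  simp only [TrivSqZeroExt.snd_add, TrivSqZeroExt.snd_inl, TrivSqZeroExt.snd_inr, zero_add] at h3
  rw [currentDer, h3]
  have : MvPolynomial.mkDerivation ℂ (fun _ : ArcVar n l => (0 : ArcPoly n l)) = 0 :=
    MvPolynomial.derivation_ext fun v => by simp
  rw [this, Derivation.zero_apply]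

lemma constantCoeff_currentDer (H : Matrix (Fin n) (Fin n) ℂ) (a : ℕ) (f : ArcPoly n l) :
    MvPolynomial.constantCoeff (currentDer l H a f) = 0 := by
  induction f using MvPolynomial.induction_on with
  | C c => rw [currentDer, MvPolynomial.derivation_C, map_zero]
  | add p q hp hq => rw [map_add, map_add, hp, hq, add_zero]
  | mul_X p v hp =>
    rw [Derivation.leibniz, map_add, smul_eq_mul, smul_eq_mul, map_mul, map_mul, hp, mul_zero,
      add_zero, currentDer, MvPolynomial.mkDerivation_X]
    split_ifs <;> simp [map_sum, MvPolynomial.smul_eq_C_mul]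

lemma derivation_sum_apply {ι A : Type*} [CommRing A] [Algebra ℂ A] (s : Finset ι)
    (d : ι → Derivation ℂ A A) (f : A) : (∑ i ∈ s, d i) f = ∑ i ∈ s, d i f := by
  have := map_sum (Derivation.coeFnAddMonoidHom (R := ℂ) (A := A) (M := A)) d s
  exact (congrFun this f).trans (Finset.sum_apply _ _ _)

/-- The commutator of a partial derivative with a linear vector field has constant coefficients;
both sides are derivations, so the variables suffice. -/
lemma pderiv_currentDer (H : Matrix (Fin n) (Fin n) ℂ) (a : ℕ) (u : ArcVar n l)
    (f : ArcPoly n l) :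
    MvPolynomial.pderiv u (currentDer l H a f) = currentDer l H a (MvPolynomial.pderiv u f) +
      ∑ i, H i u.1 • MvPolynomial.pderiv (i, u.2.1, u.2.2 + a) f := by
  have h : ⁅MvPolynomial.pderiv (R := ℂ) u, currentDer l H a⁆ =
      ∑ i, H i u.1 • MvPolynomial.pderiv (R := ℂ) (i, u.2.1, u.2.2 + a) := by
    refine MvPolynomial.derivation_ext fun v => ?_
    obtain ⟨j, c, k⟩ := u
    obtain ⟨i, c', k'⟩ := v
    rw [Derivation.commutator_apply, currentDer, MvPolynomial.mkDerivation_X]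
    have h1 : MvPolynomial.mkDerivation ℂ (fun v : ArcVar n l =>
        if a ≤ v.2.2 then ∑ j, H v.1 j • MvPolynomial.X (R := ℂ) (j, v.2.1, v.2.2 - a) else 0)
        (MvPolynomial.pderiv (j, c, k) (MvPolynomial.X (i, c', k'))) = 0 := by
      rw [MvPolynomial.pderiv_X, Pi.single_apply]
      split_ifs <;> simp
    rw [h1, sub_zero, derivation_sum_apply]
    simp only [Derivation.smul_apply, MvPolynomial.pderiv_X, Pi.single_apply, Prod.mk.injEq]
    split_ifs with hak
    · rw [map_sum]
      simp only [Derivation.map_smul, MvPolynomial.pderiv_X, Pi.single_apply, Prod.mk.injEq]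
      by_cases hc : c' = c ∧ k' = k + a
      · have : k' - a = k := by omega
        simp [hc.1, hc.2]
      · have h2 : ¬(c' = c ∧ k' - a = k) := fun h => hc ⟨h.1, by omega⟩
        simp [hc, h2]
    · have : k' ≠ k + a := by omega
      simp [this]
  have h2 := DFunLike.congr_fun h f
  rw [Derivation.commutator_apply, derivation_sum_apply] at h2
  rw [← sub_eq_iff_eq_add', h2]
  rfl

/-! ### Polarization -/

section IteratedDerivatives

variable {σ : Type*}

/-- Iterated partial derivatives. -/
def iterDeriv : ∀ {m : ℕ}, (Fin m → σ) → MvPolynomial σ ℂ →ₗ[ℂ] MvPolynomial σ ℂ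
  | 0, _ => LinearMap.id
  | _ + 1, u => (iterDeriv (Fin.tail u)).comp (MvPolynomial.pderiv (u 0)).toLinearMap

lemma iterDeriv_succ {m : ℕ} (u : Fin (m + 1) → σ) (f : MvPolynomial σ ℂ) :
    iterDeriv u f = iterDeriv (Fin.tail u) (MvPolynomial.pderiv (u 0) f) := rfl

/-- The coefficients of the polarization of a polynomial. -/
def polar {m : ℕ} (f : MvPolynomial σ ℂ) (u : Fin m → σ) : ℂ :=
  MvPolynomial.constantCoeff (iterDeriv u f)

lemma polar_succ {m : ℕ} (f : MvPolynomial σ ℂ) (u : Fin (m + 1) → σ) :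
    polar f u = polar (MvPolynomial.pderiv (u 0) f) (Fin.tail u) := rfl

lemma polar_eq_zero {m : ℕ} (T : Set σ) (f : MvPolynomial σ ℂ)
    (hf : ∀ v ∉ T, MvPolynomial.pderiv v f = 0) (u : Fin m → σ) (p : Fin m) (hp : u p ∉ T) :
    polar f u = 0 := by
  have hcomm : ∀ (v v' : σ) (f : MvPolynomial σ ℂ), MvPolynomial.pderiv v (MvPolynomial.pderiv v' f) =
      MvPolynomial.pderiv v' (MvPolynomial.pderiv v f) := by
    classical
    intro v v' f
    have h : ⁅MvPolynomial.pderiv (R := ℂ) v, MvPolynomial.pderiv (R := ℂ) v'⁆ = 0 := by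
      refine MvPolynomial.derivation_ext fun x => ?_
      rw [Derivation.commutator_apply, MvPolynomial.pderiv_X, MvPolynomial.pderiv_X,
        Pi.single_apply, Pi.single_apply]
      split_ifs <;> simp
    have h2 := DFunLike.congr_fun h f
    rwa [Derivation.commutator_apply, Derivation.zero_apply, sub_eq_zero] at h2
  induction m generalizing f with
  | zero => exact p.elim0
  | succ m ih =>
    rw [polar_succ]
    by_cases h0 : p = 0
    · subst h0
      rw [hf _ hp, polar, map_zero, map_zero]
    · obtain ⟨q, rfl⟩ := Fin.exists_succ_eq.2 h0
      exact ih _ (fun v hv => by rw [hcomm, hf v hv, map_zero]) (Fin.tail u) q hp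

/-- Taylor's formula. -/
lemma sum_polar_monomial {ι : Type*} [Fintype ι] (θ : ι → σ) (hθ : Function.Injective θ)
    (m : ℕ) (s : σ →₀ ℕ) (c : ℂ) (hs : ∀ v ∈ s.support, v ∈ Set.range θ) :
    ∑ u : Fin m → ι, polar (MvPolynomial.monomial s c) (fun p => θ (u p)) •
      ∏ p, (MvPolynomial.X (θ (u p)) : MvPolynomial σ ℂ) =
      if s.degree = m then (m.factorial : ℂ) • MvPolynomial.monomial s c else 0 := by
  classical
  induction m generalizing s c with
  | zero =>
    rw [Fintype.sum_unique]
    by_cases h : s = 0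
    · subst h
      simp [polar, iterDeriv, MvPolynomial.monomial_zero', MvPolynomial.smul_eq_C_mul]
    · rw [if_neg (by rwa [Finsupp.degree_eq_zero_iff])]
      simp [polar, iterDeriv, MvPolynomial.constantCoeff_monomial, h]
  | succ m ih =>
    rw [← (Fin.consEquiv fun _ => ι).sum_comp, Fintype.sum_prod_type]
    have h1 : ∀ i : ι, ∑ u : Fin m → ι, polar (MvPolynomial.monomial s c)
        (fun p => θ ((Fin.consEquiv fun _ => ι) (i, u) p)) •
          ∏ p, (MvPolynomial.X (θ ((Fin.consEquiv fun _ => ι) (i, u) p)) : MvPolynomial σ ℂ) =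
        (s (θ i) : ℂ) • if s.degree = m + 1 then
          (m.factorial : ℂ) • MvPolynomial.monomial s c else 0 := by
      intro i
      have h2 := ih (s - Finsupp.single (θ i) 1) (c * s (θ i)) fun v hv =>
        hs v (Finsupp.support_mono tsub_le_self hv)
      rw [← MvPolynomial.pderiv_monomial] at h2
      have h3 : ∀ u : Fin m → ι, polar (MvPolynomial.monomial s c)
          (fun p => θ ((Fin.consEquiv fun _ => ι) (i, u) p)) •
          ∏ p, (MvPolynomial.X (θ ((Fin.consEquiv fun _ => ι) (i, u) p)) : MvPolynomial σ ℂ) =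
          MvPolynomial.X (θ i) * (polar (MvPolynomial.pderiv (θ i) (MvPolynomial.monomial s c))
            (fun p => θ (u p)) • ∏ p, (MvPolynomial.X (θ (u p)) : MvPolynomial σ ℂ)) := by
        intro u
        rw [polar_succ, Fin.prod_univ_succ, mul_smul_comm]
        simp only [Fin.consEquiv, Equiv.coe_fn_mk, Fin.cons_zero, Fin.cons_succ]
        rfl
      rw [Finset.sum_congr rfl fun u _ => h3 u, ← Finset.mul_sum, h2]
      by_cases h0 : s (θ i) = 0
      · simp [MvPolynomial.pderiv_monomial, h0]
      have hle : Finsupp.single (θ i) 1 ≤ s := by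
        rw [Finsupp.single_le_iff]; omega
      have hdeg : s.degree = (s - Finsupp.single (θ i) 1).degree + 1 := by
        conv_lhs => rw [← tsub_add_cancel_of_le hle]
        rw [map_add, Finsupp.degree_single]
      by_cases hd : (s - Finsupp.single (θ i) 1).degree = m
      · rw [if_pos hd, if_pos (by omega), MvPolynomial.pderiv_monomial, mul_smul_comm,
          MvPolynomial.X, MvPolynomial.monomial_mul, one_mul, add_tsub_cancel_of_le hle,
          smul_comm, MvPolynomial.smul_monomial (s (θ i) : ℂ), smul_eq_mul, mul_comm c]
      · rw [if_neg hd, if_neg (by omega), mul_zero, smul_zero]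
    rw [Finset.sum_congr rfl fun i _ => h1 i, ← Finset.sum_smul]
    split_ifs with hd
    -- Euler's identity: the exponents add up to the degree, which turns `m !` into `(m + 1) !`.
    · have h4 : ∑ i, s (θ i) = m + 1 := by
        rw [← hd, Finsupp.degree_apply, ← Finset.sum_image (s := Finset.univ) (f := s) hθ.injOn]
        refine (Finset.sum_subset (fun v hv => ?_) fun v _ hv => ?_).symm
        · obtain ⟨i, rfl⟩ := hs v hv
          exact Finset.mem_image_of_mem _ (Finset.mem_univ i)
        · simpa using hv
      rw [← Nat.cast_sum, h4, smul_smul, Nat.factorial_succ, Nat.cast_mul]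
    · rw [smul_zero]

lemma sum_polar {ι : Type*} [Fintype ι] (θ : ι → σ) (hθ : Function.Injective θ)
    (m : ℕ) (f : MvPolynomial σ ℂ) (hf : ∀ v ∈ f.vars, v ∈ Set.range θ) :
    ∑ u : Fin m → ι, polar f (fun p => θ (u p)) •
      ∏ p, (MvPolynomial.X (θ (u p)) : MvPolynomial σ ℂ) =
      (m.factorial : ℂ) • MvPolynomial.homogeneousComponent m f := by
  have h1 : ∀ u : Fin m → σ, polar f u =
      ∑ s ∈ f.support, polar (MvPolynomial.monomial s (MvPolynomial.coeff s f)) u := by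
    intro u
    simp only [polar]
    conv_lhs => rw [f.as_sum, map_sum, map_sum]
  have h2 : MvPolynomial.homogeneousComponent m f = ∑ s ∈ f.support,
      if s.degree = m then MvPolynomial.monomial s (MvPolynomial.coeff s f) else 0 := by
    conv_lhs => rw [f.as_sum, map_sum]
    refine Finset.sum_congr rfl fun s _ => ?_
    rw [MvPolynomial.homogeneousComponent_of_mem (MvPolynomial.isHomogeneous_monomial _ rfl)]
    simp only [eq_comm]
  simp only [h1, Finset.sum_smul]
  rw [Finset.sum_comm, h2, Finset.smul_sum]
  refine Finset.sum_congr rfl fun s hs => ?_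
  rw [sum_polar_monomial θ hθ m s _ fun v hv => 
    hf v ((MvPolynomial.mem_vars_iff_mem_support v).2 ⟨s, hs, hv⟩)]
  split_ifs <;> simp

end IteratedDerivatives

lemma iterDeriv_currentDer {m : ℕ} (H : Matrix (Fin n) (Fin n) ℂ) (a : ℕ)
    (u : Fin m → ArcVar n l) (f : ArcPoly n l) :
    iterDeriv u (currentDer l H a f) = currentDer l H a (iterDeriv u f) +
      ∑ p, ∑ i, H i (u p).1 •
        iterDeriv (update u p (i, (u p).2.1, (u p).2.2 + a)) f := by
  induction m generalizing f with
  | zero => simp [iterDeriv]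
  | succ m ih =>
    rw [iterDeriv_succ, pderiv_currentDer, map_add, ih, iterDeriv_succ, Fin.sum_univ_succ,
      add_assoc, map_sum, add_comm (∑ p, _)]
    congr 2
    · refine Finset.sum_congr rfl fun i _ => ?_
      rw [map_smul, iterDeriv_succ, Fin.tail_update_zero, Function.update_self]
    · refine Finset.sum_congr rfl fun p _ => Finset.sum_congr rfl fun i _ => ?_
      rw [iterDeriv_succ, Fin.tail_update_succ, Function.update_of_ne (Fin.succ_ne_zero p).symm]
      rfl

/-- At the origin a linear vector field vanishes, so the commutator terms alone remain: the
polarization is invariant under `H t^a` acting on one tensor factor at a time. -/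
lemma sum_polar_update_eq_zero {m : ℕ} (H : Matrix (Fin n) (Fin n) ℂ) (a : ℕ)
    (f : ArcPoly n l) (hf : currentDer l H a f = 0) (u : Fin m → ArcVar n l) :
    ∑ p, ∑ i, H i (u p).1 * polar f (update u p (i, (u p).2.1, (u p).2.2 + a)) = 0 := by
  have h := congrArg MvPolynomial.constantCoeff (iterDeriv_currentDer H a u f)
  rw [hf, map_zero, map_zero, map_add, constantCoeff_currentDer, zero_add, map_sum] at h
  rw [h]
  refine Finset.sum_congr rfl fun p _ => ?_
  rw [map_sum]
  refine Finset.sum_congr rfl fun i _ => ?_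
  rw [MvPolynomial.smul_eq_C_mul, map_mul, MvPolynomial.constantCoeff_C, polar]

end

/-! ### From invariant functionals to maximal minors -/

section

variable {n l m N : ℕ}

/-- The determinant of the columns `c` of the generic matrix of power series. -/
def detSeries (c : Fin n → Fin l) : (ArcPoly n l)⟦X⟧ :=
  (Matrix.of fun i q => genericArc n l i (c q)).det

/-- The algebra generated by the coefficients of the maximal minors of the generic matrix. -/
def detAlg (n l : ℕ) : Subalgebra ℂ (ArcPoly n l) :=
  Algebra.adjoin ℂ {x | ∃ (c : Fin n → Fin l) (e : ℕ), x = PowerSeries.coeff e (detSeries c)}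

lemma det_letterMatrix_eq_sum (v : Fin n → Fin n) :
    (letterMatrix fun q => (v q).val).det =
      ∑ σ : Equiv.Perm (Fin n), if v = σ then ((Equiv.Perm.sign σ : ℤ) : ℂ) else 0 := by
  rw [← Matrix.det_transpose, Matrix.det_apply']
  refine Finset.sum_congr rfl fun σ _ => ?_
  split_ifs with h
  · rw [Finset.prod_eq_one, mul_one]
    intro q _
    rw [Matrix.transpose_apply]
    exact if_pos (by rw [h])
  · obtain ⟨q, hq⟩ : ∃ q, v q ≠ σ q := by
      by_contra hc
      push Not at hc
      exact h (funext hc)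
    rw [Finset.prod_eq_zero (Finset.mem_univ q), mul_zero]
    rw [Matrix.transpose_apply]
    exact if_neg fun h => hq (Fin.ext h)

/-- The Leibniz formula summed over all words instead of permutations, the others having sign zero,
so that it matches `blockSign`. -/
lemma coeff_detSeries (c : Fin n → Fin l) (e : ℕ) :
    PowerSeries.coeff e (detSeries c) =
      ∑ x ∈ (Finset.univ : Finset (Fin n → Fin n)) ×ˢ Finset.finsuppAntidiag Finset.univ e,
        (letterMatrix fun q => (x.1 q).val).det •
          ∏ q, (MvPolynomial.X (x.1 q, c q, x.2 q) : ArcPoly n l) := by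
  rw [Finset.sum_product, detSeries, Matrix.det_apply, map_sum]
  simp only [det_letterMatrix_eq_sum, Finset.sum_smul, ite_smul, zero_smul]
  rw [Finset.sum_congr rfl fun v _ => Finset.sum_comm, Finset.sum_comm]
  refine Finset.sum_congr rfl fun σ _ => ?_
  rw [Finset.sum_eq_single (σ : Fin n → Fin n)]
  · simp only [if_true]
    rw [← Finset.smul_sum, Units.smul_def, map_zsmul, ← Int.cast_smul_eq_zsmul ℂ,
      PowerSeries.coeff_prod]
    congr 1
    refine Finset.sum_congr rfl fun k _ => Finset.prod_congr rfl fun q _ => ?_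
    simp [genericArc]
  · intro v _ hv
    simp [hv]
  · simp

lemma mapDomain_blocks_apply (π : Blocks m n N) (k : Fin m →₀ ℕ) (b : Fin N) :
    k.mapDomain π.1 b = ∑ q, k (blockEquiv π (b, q)) := by
  rw [Finsupp.mapDomain, Finsupp.sum_fintype _ _ (fun _ => Finsupp.single_zero _),
    Finsupp.finsetSum_apply, ← (blockEquiv π).sum_comp, Fintype.sum_prod_type]
  simp only [blockEquiv_apply, Finsupp.single_apply]
  rw [Finset.sum_eq_single b]
  · simp
  · intro b' _ h
    simp [h]
  · simp

/-- A word with exponents of block degrees `e` is an independent choice of a word and of exponents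
in each block, so the sum is the expanded product of the determinants. -/
lemma sum_blockSign_prod_eq (π : Blocks m n N) (c : Fin m → Fin l) (d : ℕ) (e : Fin N →₀ ℕ)
    (he : ∑ b, e b = d) :
    ∑ w : Fin m → Fin n, ∑ k ∈ Finset.finsuppAntidiag Finset.univ d with k.mapDomain π.1 = e,
      blockSign π (fun p => (w p).val) •
        ∏ p, (MvPolynomial.X (w p, c p, k p) : ArcPoly n l) =
      ∏ b, PowerSeries.coeff (e b) (detSeries fun q => c (blockEquiv π (b, q))) := by
  classical
  simp only [coeff_detSeries]
  rw [Finset.prod_univ_sum, ← Finset.sum_product']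
  refine Finset.sum_bij'
    (fun x _ b => (fun q => x.1 (blockEquiv π (b, q)),
      Finsupp.equivFunOnFinite.symm fun q => x.2 (blockEquiv π (b, q))))
    (fun y _ => (fun p => (y ((blockEquiv π).symm p).1).1 ((blockEquiv π).symm p).2,
      Finsupp.equivFunOnFinite.symm fun p =>
        (y ((blockEquiv π).symm p).1).2 ((blockEquiv π).symm p).2)) ?_ ?_ ?_ ?_ ?_
  · rintro ⟨w, k⟩ hx
    simp only [Finset.mem_product, Finset.mem_univ, true_and, Finset.mem_filter] at hx
    simp only [Fintype.mem_piFinset, Finset.mem_product, Finset.mem_univ, true_and,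
      Finset.mem_finsuppAntidiag, Finset.subset_univ, and_true, Finsupp.equivFunOnFinite_symm_apply_apply]
    intro b
    rw [← hx.2, mapDomain_blocks_apply]
  · intro y hy
    simp only [Fintype.mem_piFinset, Finset.mem_product, Finset.mem_univ, true_and,
      Finset.mem_finsuppAntidiag, Finset.subset_univ, and_true] at hy
    simp only [Finset.mem_product, Finset.mem_univ, true_and, Finset.mem_filter,
      Finset.mem_finsuppAntidiag, Finset.subset_univ, and_true,
      Finsupp.equivFunOnFinite_symm_apply_apply]
    refine ⟨?_, ?_⟩
    · rw [← (blockEquiv π).sum_comp, Fintype.sum_prod_type, ← he]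
      refine Finset.sum_congr rfl fun b _ => ?_
      rw [← hy b]
      simp
    · ext b
      rw [mapDomain_blocks_apply, ← hy b]
      simp
  · rintro ⟨w, k⟩ _
    refine Prod.ext ?_ ?_
    · funext p; simp
    · ext p; simp
  · intro y _
    funext b
    refine Prod.ext ?_ ?_
    · funext q; simp
    · ext q; simp
  · rintro ⟨w, k⟩ _
    rw [← (blockEquiv π).prod_comp, Fintype.prod_prod_type, blockSign]
    rw [← Finset.prod_smul]
    rfl

/-- Identifying variables within blocks, `blockEval π` sees only the block degrees of an exponent.
Grouping by these gives products of coefficients of determinants, weighted by the values of `G` on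
monomials. -/
lemma sum_blockEval_mem_detAlg (π : Blocks m n N) (c : Fin m → Fin l) (d : ℕ)
    (G : MvPolynomial (Fin N) ℂ →ₗ[ℂ] ℂ) :
    ∑ w : Fin m → Fin n, ∑ k ∈ Finset.finsuppAntidiag Finset.univ d,
      G (blockEval π (fun p => (w p).val) (MvPolynomial.monomial k 1)) •
        ∏ p, (MvPolynomial.X (w p, c p, k p) : ArcPoly n l) ∈ detAlg n l := by
  classical
  let T : Finset (Fin N →₀ ℕ) :=
    (Finset.finsuppAntidiag Finset.univ d).image fun k : Fin m →₀ ℕ => k.mapDomain π.1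
  have h1 : ∀ w : Fin m → Fin n, ∑ k ∈ Finset.finsuppAntidiag Finset.univ d,
      G (blockEval π (fun p => (w p).val) (MvPolynomial.monomial k 1)) •
        ∏ p, (MvPolynomial.X (w p, c p, k p) : ArcPoly n l) =
      ∑ e ∈ T, G (MvPolynomial.monomial e 1) •
        ∑ k ∈ Finset.finsuppAntidiag Finset.univ d with k.mapDomain π.1 = e,
          blockSign π (fun p => (w p).val) •
            ∏ p, (MvPolynomial.X (w p, c p, k p) : ArcPoly n l) := by
    intro w
    rw [← Finset.sum_fiberwise_of_maps_to (t := T) (g := fun k : Fin m →₀ ℕ => k.mapDomain π.1)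
      fun k hk => Finset.mem_image_of_mem _ hk]
    refine Finset.sum_congr rfl fun e _ => ?_
    rw [Finset.smul_sum]
    refine Finset.sum_congr rfl fun k hk => ?_
    rw [Finset.mem_filter] at hk
    rw [blockEval_apply, MvPolynomial.rename_monomial, hk.2, map_smul, smul_smul, smul_eq_mul,
      mul_comm]
  rw [Finset.sum_congr rfl fun w _ => h1 w, Finset.sum_comm]
  refine Subalgebra.sum_mem _ fun e he => ?_
  rw [← Finset.smul_sum, sum_blockSign_prod_eq]
  · refine Subalgebra.smul_mem _ (Subalgebra.prod_mem _ fun b _ => Algebra.subset_adjoin ?_) _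
    exact ⟨_, _, rfl⟩
  · obtain ⟨k, hk, rfl⟩ := Finset.mem_image.1 he
    rw [Finset.mem_finsuppAntidiag] at hk
    rw [← hk.1, ← (blockEquiv π).sum_comp, Fintype.sum_prod_type]
    exact Finset.sum_congr rfl fun b _ => mapDomain_blocks_apply π k b

/-- The family of linear functionals given by the part of the polarization of `f` which is linear in
the columns `c`. -/
def polarFamily (f : ArcPoly n l) (c : Fin m → Fin l) (w : Fin m → ℕ) :
    MvPolynomial (Fin m) ℂ →ₗ[ℂ] ℂ :=
  if h : ∀ p, w p < n then
    (MvPolynomial.basisMonomials (Fin m) ℂ).constr ℂ fun k =>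
      polar f fun p => ((⟨w p, h p⟩, c p, k p) : ArcVar n l)
  -- Letters `≥ n` have no coordinate; zero is the value that `IsBalanced.content` requires.
  else 0

lemma polarFamily_monomial (f : ArcPoly n l) (c : Fin m → Fin l) (w : Fin m → Fin n)
    (k : Fin m →₀ ℕ) :
    polarFamily f c (fun p => (w p).val) (MvPolynomial.monomial k 1) =
      polar f fun p => ((w p, c p, k p) : ArcVar n l) := by
  rw [polarFamily, dif_pos fun p => (w p).2]
  have := (MvPolynomial.basisMonomials (Fin m) ℂ).constr_basis ℂ
    (fun k => polar f fun p => ((w p, c p, k p) : ArcVar n l)) k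
  rwa [MvPolynomial.coe_basisMonomials] at this

lemma polarFamily_eq_zero (f : ArcPoly n l) (c : Fin m → Fin l) (w : Fin m → ℕ) (p : Fin m)
    (h : n ≤ w p) : polarFamily f c w = 0 :=
  dif_neg fun h' => absurd (h' p) (not_lt.2 h)

section Invariant

variable {f : ArcPoly n l}

lemma sum_polar_single (hf : ∀ H : Matrix (Fin n) (Fin n) ℂ, H.trace = 0 → ∀ a,
    currentDer l H a f = 0) (c : Fin m → Fin l) (w : Fin m → Fin n) (k : Fin m →₀ ℕ) (a : ℕ)
    (i j : Fin n) (hij : i ≠ j) :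
    ∑ p with w p = i, polar f (fun q => ((update w p j q, c q, (k + Finsupp.single p a) q) :
      ArcVar n l)) = 0 := by
  have h := sum_polar_update_eq_zero (Matrix.single j i 1) a f
    (hf _ (Matrix.trace_single_eq_of_ne _ _ _ hij.symm) a) fun q => ((w q, c q, k q) : ArcVar n l)
  rw [← h, Finset.sum_filter]
  refine Finset.sum_congr rfl fun p _ => ?_
  rw [Finset.sum_eq_single j]
  · simp only [Matrix.single_apply, true_and, eq_comm (a := i)]
    split_ifs with hp
    · rw [one_mul]
      congr 1
      funext q
      by_cases hq : q = p
      · subst hq; simp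
      · simp [hq]
    · rw [zero_mul]
  · intro i' _ hi'
    simp [hi'.symm]
  · simp

lemma sum_polar_eq_sum_polar (hf : ∀ H : Matrix (Fin n) (Fin n) ℂ, H.trace = 0 → ∀ a,
    currentDer l H a f = 0) (c : Fin m → Fin l) (w : Fin m → Fin n) (k : Fin m →₀ ℕ) (a : ℕ)
    (i j : Fin n) :
    ∑ p with w p = i, polar f (fun q => ((w q, c q, (k + Finsupp.single p a) q) : ArcVar n l)) =
      ∑ p with w p = j, polar f (fun q => ((w q, c q, (k + Finsupp.single p a) q) :
        ArcVar n l)) := by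
  have h := sum_polar_update_eq_zero (Matrix.diagonal (Pi.single i 1 - Pi.single j 1)) a f
    (hf _ (by simp [Matrix.trace_diagonal]) a) fun q => ((w q, c q, k q) : ArcVar n l)
  have h1 : ∀ p, ∑ i', (Matrix.diagonal (Pi.single i 1 - Pi.single j 1) : Matrix _ _ ℂ) i' (w p) *
      polar f (update (fun q => ((w q, c q, k q) : ArcVar n l)) p (i', c p, k p + a)) =
      (if w p = i then polar f (fun q => ((w q, c q, (k + Finsupp.single p a) q) : ArcVar n l))
        else 0) -
      (if w p = j then polar f (fun q => ((w q, c q, (k + Finsupp.single p a) q) : ArcVar n l))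
        else 0) := by
    intro p
    have hu : update (fun q => ((w q, c q, k q) : ArcVar n l)) p (w p, c p, k p + a) =
        fun q => ((w q, c q, (k + Finsupp.single p a) q) : ArcVar n l) := by
      funext q
      by_cases hq : q = p
      · subst hq; simp
      · simp [hq]
    rw [Finset.sum_eq_single (w p), hu, Matrix.diagonal_apply_eq, Pi.sub_apply, Pi.single_apply,
      Pi.single_apply]
    · split_ifs <;> ring
    · intro i' _ hi'
      rw [Matrix.diagonal_apply_ne _ hi', zero_mul]
    · simp
  rw [Finset.sum_congr rfl fun p _ => h1 p, Finset.sum_sub_distrib, ← Finset.sum_filter,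
    ← Finset.sum_filter] at h
  exact sub_eq_zero.1 h

lemma X_pow_mul_monomial (p : Fin m) (a : ℕ) (k : Fin m →₀ ℕ) :
    MvPolynomial.X p ^ a * MvPolynomial.monomial k (1 : ℂ) =
      MvPolynomial.monomial (k + Finsupp.single p a) 1 := by
  rw [MvPolynomial.X_pow_eq_monomial, MvPolynomial.monomial_mul, mul_one, add_comm]

/-- Off-diagonal matrix units give `raise`, differences of diagonal ones give `balance`, and the
latter with `a = 0` give the weight condition. -/
lemma isBalanced_polarFamily (hf : ∀ H : Matrix (Fin n) (Fin n) ℂ, H.trace = 0 → ∀ a,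
    currentDer l H a f = 0) (c : Fin m → Fin l) : IsBalanced n (m / n) (polarFamily f c) where
  raise i j hij w a g := by
    suffices h : ∑ p with w p = i, (polarFamily f c (update w p j)).comp
        (LinearMap.mulLeft ℂ (MvPolynomial.X p ^ a)) = 0 by
      simpa using LinearMap.congr_fun h g
    refine linearMap_eq_zero fun k => ?_
    simp only [LinearMap.sum_apply, LinearMap.comp_apply, LinearMap.mulLeft_apply,
      X_pow_mul_monomial]
    by_cases hj : j < n
    · by_cases hw : ∀ q, w q < n
      · have h := sum_polar_single hf c (fun q => ⟨w q, hw q⟩) k a ⟨i, hij.trans hj⟩ ⟨j, hj⟩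
          (by simp [hij.ne])
        simp only [Fin.mk.injEq, ← polarFamily_monomial] at h
        refine Eq.trans (Finset.sum_congr rfl fun p _ => ?_) h
        congr 2
        funext q
        by_cases hq : q = p
        · subst hq; simp
        · simp [hq]
      · push Not at hw
        obtain ⟨q, hq⟩ := hw
        refine Finset.sum_eq_zero fun p hp => ?_
        have hqp : q ≠ p := by
          rintro rfl
          rw [Finset.mem_filter] at hp
          omega
        rw [polarFamily_eq_zero f c _ q (by rwa [Function.update_of_ne hqp]), LinearMap.zero_apply]
    · refine Finset.sum_eq_zero fun p _ => ?_
      rw [polarFamily_eq_zero f c _ p (by simpa using hj), LinearMap.zero_apply]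
  balance j hj a w g := by
    suffices h : ∑ p with w p = j, (polarFamily f c w).comp
        (LinearMap.mulLeft ℂ (MvPolynomial.X p ^ (a + 1))) - ∑ p with w p = 0,
        (polarFamily f c w).comp (LinearMap.mulLeft ℂ (MvPolynomial.X p ^ (a + 1))) = 0 by
      simpa [sub_eq_zero] using LinearMap.congr_fun h g
    refine linearMap_eq_zero fun k => ?_
    simp only [LinearMap.sub_apply, LinearMap.sum_apply, LinearMap.comp_apply,
      LinearMap.mulLeft_apply, X_pow_mul_monomial]
    by_cases hw : ∀ q, w q < n
    · have h := sum_polar_eq_sum_polar hf c (fun q => ⟨w q, hw q⟩) k (a + 1) ⟨j, hj⟩ ⟨0, by omega⟩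
      simp only [Fin.mk.injEq, ← polarFamily_monomial] at h
      exact sub_eq_zero.2 h
    · push Not at hw
      obtain ⟨q, hq⟩ := hw
      simp [polarFamily_eq_zero f c w q hq]
  content w j h := by
    by_cases hw : ∀ q, w q < n
    · have hj : j < n := by
        by_contra hj
        rw [if_neg hj] at h
        obtain ⟨p, hp⟩ := Finset.card_ne_zero.1 h
        rw [Finset.mem_filter] at hp
        exact hj (hp.2 ▸ hw p)
      rw [if_pos hj] at h
      -- If all letters occurred equally often, each would occur `m / n` times. Two unequal
      -- multiplicities kill the functional through the constant Cartan element.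
      obtain ⟨i, hi⟩ : ∃ i : Fin n, Finset.card {p : Fin m | w p = i.val} ≠
          Finset.card {p : Fin m | w p = j} := by
        by_contra hc
        push Not at hc
        have h1 : m = ∑ i : Fin n, Finset.card {p : Fin m | w p = i.val} := by
          have := Finset.card_eq_sum_card_fiberwise (s := (Finset.univ : Finset (Fin m)))
            (t := (Finset.univ : Finset (Fin n))) (f := fun p => ⟨w p, hw p⟩) fun _ _ => by simp
          simpa [Fin.ext_iff] using this
        rw [Finset.sum_congr rfl fun i _ => hc i, Finset.sum_const, Finset.card_univ,
          Fintype.card_fin, smul_eq_mul] at h1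
        refine h ?_
        conv_rhs => rw [h1]
        rw [Nat.mul_div_cancel_left _ (by omega)]
      refine linearMap_eq_zero fun k => ?_
      have h1 := sum_polar_eq_sum_polar hf c (fun q => ⟨w q, hw q⟩) k 0 i ⟨j, hj⟩
      simp only [Finsupp.single_zero, add_zero, Finset.sum_const, nsmul_eq_mul, Fin.ext_iff] at h1
      rw [← polarFamily_monomial] at h1
      by_contra h0
      exact hi (by exact_mod_cast mul_right_cancel₀ h0 h1)
    · push Not at hw
      obtain ⟨q, hq⟩ := hw
      exact polarFamily_eq_zero f c w q hq

lemma sum_polarFamily_mem_detAlg (hn : 0 < n) (hf : ∀ H : Matrix (Fin n) (Fin n) ℂ, H.trace = 0 →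
    ∀ a, currentDer l H a f = 0) (c : Fin m → Fin l) (d : ℕ) :
    ∑ w : Fin m → Fin n, ∑ k ∈ Finset.finsuppAntidiag Finset.univ d,
      polarFamily f c (fun p => (w p).val) (MvPolynomial.monomial k 1) •
        ∏ p, (MvPolynomial.X (w p, c p, k p) : ArcPoly n l) ∈ detAlg n l := by
  have hB := isBalanced_polarFamily hf c
  -- No such map exists only when `0 < m < n`, where the weight condition already gives zero.
  by_cases hne : Nonempty (Fin m → Fin (m / n))
  · obtain ⟨G, hG⟩ := hB.exists_eq_sum hn
    simp only [hG, Finset.sum_smul]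
    rw [Finset.sum_congr rfl fun w _ => Finset.sum_comm, Finset.sum_comm]
    exact Subalgebra.sum_mem _ fun π _ => sum_blockEval_mem_detAlg π c d (G π)
  · have hz : ∀ w, polarFamily f c w = 0 := by
      intro w
      have hN : m / n = 0 := by
        by_contra h
        exact hne ⟨fun _ => ⟨0, Nat.pos_of_ne_zero h⟩⟩
      have hm : 0 < m := by
        by_contra h
        obtain rfl : m = 0 := by omega
        exact hne ⟨Fin.elim0⟩
      refine hB.content w (w ⟨0, hm⟩) ?_
      rw [hN, ite_self, Finset.card_ne_zero]
      exact ⟨⟨0, hm⟩, by simp⟩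
    simp [hz]

/-- Regroups exponents by total degree `d`, the form in which membership in `detAlg` is proved;
exponents below `K` have total at most `m * K`. -/
lemma sum_finsuppAntidiag_eq {V : Type*} [AddCommMonoid V] (K : ℕ) (h : (Fin m →₀ ℕ) → V)
    (h0 : ∀ k, (∃ p, K ≤ k p) → h k = 0) :
    ∑ k : Fin m → Fin K, h (Finsupp.equivFunOnFinite.symm fun p => (k p).val) =
      ∑ d ∈ Finset.range (m * K + 1), ∑ k ∈ Finset.finsuppAntidiag Finset.univ d, h k := by
  classical
  rw [← Finset.sum_biUnion]
  · let e : (Fin m → Fin K) → (Fin m →₀ ℕ) := fun k =>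
      Finsupp.equivFunOnFinite.symm fun p => (k p).val
    have he : Function.Injective e := fun k k' hk => by
      funext p
      exact Fin.ext (DFunLike.congr_fun hk p)
    rw [← Finset.sum_image (s := Finset.univ) (f := h) (g := e) he.injOn]
    refine Finset.sum_subset ?_ ?_
    · intro k hk
      obtain ⟨k, -, rfl⟩ := Finset.mem_image.1 hk
      simp only [Finset.mem_biUnion, Finset.mem_range, Finset.mem_finsuppAntidiag,
        Finset.subset_univ, and_true]
      refine ⟨_, Nat.lt_succ_of_le ?_, rfl⟩
      refine (Finset.sum_le_card_nsmul _ _ K fun p _ => (k p).2.le).trans ?_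
      simp
    · intro k _ hk
      refine h0 k ?_
      by_contra hc
      push Not at hc
      refine hk (Finset.mem_image.2 ⟨fun p => ⟨k p, hc p⟩, Finset.mem_univ _, ?_⟩)
      ext p
      rfl
  · intro d _ d' _ hdd
    rw [Function.onFun, Finset.disjoint_left]
    intro k hk hk'
    rw [Finset.mem_finsuppAntidiag] at hk hk'
    exact hdd (hk.1.symm.trans hk'.1)

/-- The functions killed by the current algebra of `sl_n` are polynomials in the coefficients of the
maximal minors. -/
theorem mem_detAlg (hn : 0 < n) (hf : ∀ H : Matrix (Fin n) (Fin n) ℂ, H.trace = 0 →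
    ∀ a, currentDer l H a f = 0) : f ∈ detAlg n l := by
  classical
  rw [← MvPolynomial.sum_homogeneousComponent f]
  refine Subalgebra.sum_mem _ fun m _ => ?_
  -- A strict bound for the orders in `t` occurring in `f`; it makes the sums in Taylor's formula
  -- finite.
  let K := ∑ v ∈ f.vars, (v.2.2 + 1)
  have hK : ∀ v ∈ f.vars, v.2.2 < K := fun v hv =>
    Nat.lt_of_succ_le (Finset.single_le_sum (f := fun v : ArcVar n l => v.2.2 + 1)
      (fun _ _ => Nat.zero_le _) hv)
  let θ : Fin n × Fin l × Fin K → ArcVar n l := fun x => (x.1, x.2.1, x.2.2.val)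
  have hθ : Function.Injective θ := by
    rintro ⟨i, c, k⟩ ⟨i', c', k'⟩ h
    simp only [θ, Prod.mk.injEq] at h
    rw [h.1, h.2.1, Fin.ext h.2.2]
  have h1 := sum_polar θ hθ m f fun v hv => ⟨(v.1, v.2.1, ⟨v.2.2, hK v hv⟩), rfl⟩
  have hm : (m.factorial : ℂ) ≠ 0 := Nat.cast_ne_zero.2 m.factorial_ne_zero
  rw [← inv_smul_smul₀ hm (MvPolynomial.homogeneousComponent m f), ← h1]
  refine Subalgebra.smul_mem _ ?_ _
  let E : (Fin m → Fin l) × (Fin m → Fin n) × (Fin m → Fin K) ≃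
      (Fin m → Fin n × Fin l × Fin K) :=
    ⟨fun x p => (x.2.1 p, x.1 p, x.2.2 p),
      fun u => (fun p => (u p).2.1, fun p => (u p).1, fun p => (u p).2.2),
      fun _ => rfl, fun _ => rfl⟩
  rw [← E.sum_comp, Fintype.sum_prod_type]
  refine Subalgebra.sum_mem _ fun c _ => ?_
  rw [Fintype.sum_prod_type]
  have h2 : ∀ w : Fin m → Fin n, ∑ k : Fin m → Fin K,
      polar f (fun p => θ (E (c, w, k) p)) •
        ∏ p, (MvPolynomial.X (θ (E (c, w, k) p)) : ArcPoly n l) =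
      ∑ d ∈ Finset.range (m * K + 1), ∑ k ∈ Finset.finsuppAntidiag Finset.univ d,
        polarFamily f c (fun p => (w p).val) (MvPolynomial.monomial k 1) •
          ∏ p, (MvPolynomial.X (w p, c p, k p) : ArcPoly n l) := by
    intro w
    rw [← sum_finsuppAntidiag_eq K (fun k =>
      polarFamily f c (fun p => (w p).val) (MvPolynomial.monomial k 1) •
        ∏ p, (MvPolynomial.X (w p, c p, k p) : ArcPoly n l))]
    · refine Finset.sum_congr rfl fun k _ => ?_
      rw [polarFamily_monomial]
      rfl
    · rintro k ⟨p, hp⟩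
      rw [polarFamily_monomial, polar_eq_zero {v : ArcVar n l | v.2.2 < K} f _ _ p (by simpa using hp),
        zero_smul]
      intro v hv
      exact MvPolynomial.pderiv_eq_zero_of_notMem_vars fun h => hv (hK v h)
  rw [Finset.sum_congr rfl fun w _ => h2 w, Finset.sum_comm]
  exact Subalgebra.sum_mem _ fun d _ => sum_polarFamily_mem_detAlg hn hf c d

end Invariant

end

/-! ### Return to the arc space and the differential algebra -/

section

variable {n l : ℕ}

lemma coeff_eq_coeff_univ {R : Type*} [CommRing R] [Algebra ℂ R] (r : R) (k : ℕ) :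
    Arc.coeff r k = PowerSeries.coeff k (Arc.univ R r) :=
  (PowerSeries.coeff_mk k (Arc.coeff r)).symm

lemma ofArcPoly_coeff_detSeries (c : Fin n → Fin l) (e : ℕ) :
    ofArcPoly n l (PowerSeries.coeff e (detSeries c)) = Arc.coeff (SLInv.bracket c) e := by
  have h : PowerSeries.map (ofArcPoly n l : ArcPoly n l →+* _) (detSeries c) =
      Arc.univ _ (SLInv.bracket c) := by
    rw [detSeries, SLInv.bracket, RingHom.map_det, AlgHom.map_det]
    congr 1
    ext i q k
    simp [genericArc, ofArcPoly, coeff_eq_coeff_univ]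
  rw [coeff_eq_coeff_univ, ← h, PowerSeries.coeff_map]
  rfl

/-- The arc invariants are contained in all algebras which contain the coefficients of the
determinants. -/
theorem arcInvariants_le (S : Subalgebra ℂ (Arc.CoordRing (SLInv.OV n l)))
    (hS : ∀ (c : Fin n → Fin l) (e : ℕ), Arc.coeff (SLInv.bracket c) e ∈ S) :
    SLInv.arcInvariants n l ≤ S := by
  intro f hf
  rw [← ofArcPoly_toArcPoly f]
  -- For `n = 0` there are no coordinates and all functions are constant.
  rcases Nat.eq_zero_or_pos n with rfl | hn
  · rw [MvPolynomial.eq_C_of_isEmpty (toArcPoly 0 l f), ← MvPolynomial.algebraMap_eq,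
      AlgHom.commutes]
    exact S.algebraMap_mem _
  · have h := mem_detAlg hn fun H hH a => currentDer_eq_zero f hf H hH a
    have hle : detAlg n l ≤ S.comap (ofArcPoly n l) := by
      refine Algebra.adjoin_le ?_
      rintro _ ⟨c, e, rfl⟩
      rw [SetLike.mem_coe, Subalgebra.mem_comap, ofArcPoly_coeff_detSeries]
      exact hS c e
    exact hle h

lemma bracket_mem_invariants (c : Fin n → Fin l) : SLInv.bracket c ∈ SLInv.invariants n l := by
  intro A _ _ g M
  have h : ∀ M : Matrix (Fin n) (Fin l) A,
      SLInv.point M (SLInv.bracket c) = (M.submatrix id c).det := by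
    intro M
    rw [SLInv.bracket, AlgHom.map_det]
    congr 1
    ext i q
    simp [SLInv.point]
  rw [h, h, Matrix.submatrix_mul _ _ id id c Function.bijective_id, Matrix.det_mul]
  simp

lemma pStar_coeff (r : SLInv.invariants n l) (k : ℕ) :
    SLInv.pStar n l (Arc.coeff r k) = Arc.coeff (r : SLInv.OV n l) k := by
  rw [SLInv.pStar, Arc.map, Arc.eval_coeff, coeff_eq_coeff_univ]
  rfl

/-- An invariant of `SL_n` is invariant under the points of `SL_n` in every algebra, in particular
in `A⟦X⟧`. -/
lemma range_pStar_le : (SLInv.pStar n l).range ≤ SLInv.arcInvariants n l := by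
  rintro _ ⟨x, rfl⟩ A _ _ g M
  change (Arc.eval (SLInv.point (g.1 * M))).comp (SLInv.pStar n l) x =
    (Arc.eval (SLInv.point M)).comp (SLInv.pStar n l) x
  refine DFunLike.congr_fun (Arc.algHom_ext fun r k => ?_) x
  rw [AlgHom.comp_apply, AlgHom.comp_apply, pStar_coeff, Arc.eval_coeff, Arc.eval_coeff,
    r.2 A⟦X⟧ g M]

lemma coeff_bracket_mem_range_pStar (c : Fin n → Fin l) (e : ℕ) :
    Arc.coeff (SLInv.bracket c) e ∈ (SLInv.pStar n l).range :=
  ⟨Arc.coeff ⟨_, bracket_mem_invariants c⟩ e, pStar_coeff _ _⟩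

lemma range_pStar_eq : (SLInv.pStar n l).range = SLInv.arcInvariants n l :=
  le_antisymm range_pStar_le (arcInvariants_le _ coeff_bracket_mem_range_pStar)

/-- A `D`-stable algebra which contains `r_0` contains all `r_k`. -/
lemma coeff_mem_of_stable {R : Type*} [CommRing R] [Algebra ℂ R]
    (S : Subalgebra ℂ (Arc.CoordRing R)) (hS : ∀ f ∈ S, Arc.D R f ∈ S) (r : R)
    (h : Arc.coeff r 0 ∈ S) (k : ℕ) : Arc.coeff r k ∈ S := by
  induction k with
  | zero => exact h
  | succ k ih =>
    have h1 := hS _ ih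
    rw [Arc.D_coeff] at h1
    have hk : (k + 1 : ℂ) ≠ 0 := by exact_mod_cast Nat.succ_ne_zero k
    have h2 : Arc.coeff r (k + 1) =
        (k + 1 : ℂ)⁻¹ • (((k : Arc.CoordRing R) + 1) * Arc.coeff r (k + 1)) := by
      have : ((k : Arc.CoordRing R) + 1) = algebraMap ℂ _ (k + 1 : ℂ) := by simp
      rw [this, ← Algebra.smul_def, inv_smul_smul₀ hk]
    rw [h2]
    exact S.smul_mem h1 _

/-- Determinants alternate in the columns: sorting changes at most the sign, and a repeated column
gives zero. -/
lemma coeff_bracket_mem (S : Subalgebra ℂ (Arc.CoordRing (SLInv.OV n l)))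
    (hS : ∀ c : Fin n → Fin l, StrictMono c → ∀ e, Arc.coeff (SLInv.bracket c) e ∈ S)
    (c : Fin n → Fin l) (e : ℕ) : Arc.coeff (SLInv.bracket c) e ∈ S := by
  by_cases hc : Function.Injective c
  · have hmono : StrictMono (c ∘ Tuple.sort c) :=
      (Tuple.monotone_sort c).strictMono_of_injective (hc.comp (Tuple.sort c).injective)
    have h1 : SLInv.bracket (c ∘ Tuple.sort c) =
        (Equiv.Perm.sign (Tuple.sort c) : ℤ) • SLInv.bracket c := by
      have := Matrix.det_permute' (Tuple.sort c)
        (Matrix.of fun i k : Fin n => (MvPolynomial.X (i, c k) : SLInv.OV n l))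
      rw [zsmul_eq_mul]
      exact this
    have h2 := hS _ hmono e
    rw [h1, coeff_eq_coeff_univ, map_zsmul, map_zsmul, ← coeff_eq_coeff_univ] at h2
    rcases Int.units_eq_one_or (Equiv.Perm.sign (Tuple.sort c)) with h | h
    · simpa [h] using h2
    · simpa [h] using h2
  · rw [Function.Injective] at hc
    push Not at hc
    obtain ⟨i, j, hij, hne⟩ := hc
    have h0 : SLInv.bracket c = 0 :=
      Matrix.det_zero_of_column_eq hne fun k => by simp [hij]
    rw [h0, coeff_eq_coeff_univ, map_zero, map_zero]
    exact S.zero_mem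

lemma arcInvariants_eq_diffAdjoin :
    SLInv.arcInvariants n l =
      Arc.diffAdjoin {f | ∃ c : Fin n → Fin l, StrictMono c ∧
        f = Arc.coeff (SLInv.bracket c) 0} := by
  refine le_antisymm (le_sInf ?_) ?_
  · rintro S ⟨hS, hD⟩
    exact arcInvariants_le S (coeff_bracket_mem S fun c hc =>
      coeff_mem_of_stable S hD _ (hS ⟨c, hc, rfl⟩))
  · have hle : Algebra.adjoin ℂ {x | ∃ (c : Fin n → Fin l) (e : ℕ),
        x = Arc.coeff (SLInv.bracket c) e} ≤ SLInv.arcInvariants n l := by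
      refine Algebra.adjoin_le ?_
      rintro _ ⟨c, e, rfl⟩
      exact range_pStar_le (coeff_bracket_mem_range_pStar c e)
    -- The algebra generated by all coefficients of the determinants is `D`-stable by the formula
    -- for `D r_k`, and it lies in the invariants.
    refine le_trans (sInf_le (a := Algebra.adjoin ℂ {x | ∃ (c : Fin n → Fin l) (e : ℕ),
        x = Arc.coeff (SLInv.bracket c) e}) ⟨?_, ?_⟩) hle
    · rintro _ ⟨c, -, rfl⟩
      exact Algebra.subset_adjoin ⟨c, 0, rfl⟩
    · intro f hf
      induction hf using Algebra.adjoin_induction with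
      | mem x hx =>
        obtain ⟨c, e, rfl⟩ := hx
        rw [Arc.D_coeff]
        refine Subalgebra.mul_mem _ ?_ (Algebra.subset_adjoin ⟨c, e + 1, rfl⟩)
        exact Subalgebra.add_mem _ (Subalgebra.natCast_mem _ _) (Subalgebra.one_mem _)
      | algebraMap r =>
        rw [Derivation.map_algebraMap]
        exact Subalgebra.zero_mem _
      | add x y _ _ hx hy =>
        rw [map_add]
        exact Subalgebra.add_mem _ hx hy
      | mul x y hx' hy' hx hy =>
        rw [Derivation.leibniz, smul_eq_mul, smul_eq_mul]
        exact Subalgebra.add_mem _ (Subalgebra.mul_mem _ hx' hy) (Subalgebra.mul_mem _ hy' hx)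

end

end ArcInv

end

theorem mainTheorem9 (n l : ℕ) :
    (SLInv.pStar n l).range = SLInv.arcInvariants n l ∧
      SLInv.arcInvariants n l =
        Arc.diffAdjoin {f | ∃ c : Fin n → Fin l, StrictMono c ∧
          f = Arc.coeff (SLInv.bracket c) 0} :=
  ⟨ArcInv.range_pStar_eq, ArcInv.arcInvariants_eq_diffAdjoin⟩
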